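/- **Conventions.** A *locally conformally Kähler* (lcK) manifold $(M,g,J)$ with Lee form $\theta$ is a smooth manifold of real dimension $>2$ with an integrable complex structure $J$ and a Hermitian metric $g$ such that, writing $\omega=g(J\cdot,\cdot)$, every point has a neighbourhood $U$ with a smooth $f_U:U\to\mathbb R$ for which $e^{-f_U}\omega$ is closed and $\theta|_U=df_U$. It is *Vaisman* if $\theta$ is not exact, is parallel for the Levi-Civita connection of $g$, and has unit length. For a smooth action of a Lie group $G$ with Lie algebra $\mathfrak g$, $\overline X$ denotes the fundamental vector field of $X\in\mathfrak g$. A map $\mu:M\to\mathfrak g^*$ with smooth components $\mu^X$ is a *twisted moment map* if $d\mu^X-\mu^X\theta=\omega(\overline X,\cdot)$ for all $X\in\mathfrak g$; the action is *twisted Hamiltonian* if such a $\mu$ exists. The *minimal covering* $p:\hat M\to M$ is the connected Galois covering with $p^*\theta=dh$ for a smooth $h:\hat M\to\mathbb R$ such that the homomorphism $\gamma\mapsto h\circ\gamma-h\in\mathbb R$ on its deck transformation group is injective. Given such an $h$, the *associated Sasakian manifold* is the hypersurface $S=h^{-1}(0)\subset\hat M$; its contact form is $\eta=-d^ch|_S$,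 where $d^ch=dh\circ\hat J$ and $\hat J$ is the lift of $J$ to $\hat M$ (equivalently, $\eta$ is dual, in the metric induced by $p^*g$, to the Reeb field, the lift of $J\theta^\sharp$). An action of $G$ on $S$ is *induced* by an action on $M$ if it is the restriction to $S$ of a smooth action of $G$ on $\hat M$ lifting the given one. For a smooth action of $G$ on $S$ preserving $\eta$, the *contact moment map* is $\Phi:S\to\mathfrak g^*$, $\Phi(s)(X)=\eta_s(\overline X_s)$, where $\overline X$ is the fundamental field on $S$. **Proposition.** Let $(M,g,J)$ be a connected Vaisman manifold with Lee form $\theta$ such that $(M,g)$ is complete. Let a compact connected Lie group $G$ act smoothly on $M$ by holomorphic isometries, and suppose the action is twisted Hamiltonian with twisted moment map $\mu:M\to\mathfrak g^*$. Let $p:\hat M\to M$ be the minimal covering, $h$ a primitive of $p^*\theta$, and $S=h^{-1}(0)$ the associated Sasakian manifold with contact form $\eta$. Then $S$ carries a smooth induced action of $G$, every induced action preserves $\eta$, and its contact moment map $\Phi:S\to\mathfrak g^*$ satisfies $$\Phi(S)=\mu(M).$$ -/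

import Mathlib

open scoped Manifold ContDiff Bundle

namespace VaismanMoment

noncomputable section

section Geometry

variable {E : Type*} [NormedAddCommGroup E] [NormedSpace ℝ E]
  {M : Type*} [TopologicalSpace M] [ChartedSpace E M]

/-- A vector field on `M`. -/
abbrev VField (E : Type*) [NormedAddCommGroup E] [NormedSpace ℝ E]
    (M : Type*) [TopologicalSpace M] [ChartedSpace E M] : Type _ :=
  (x : M) → TangentSpace 𝓘(ℝ, E) x

/-- A `1`-form on `M` (a family of covectors). -/
abbrev OneForm (E : Type*) [NormedAddCommGroup E] [NormedSpace ℝ E]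
    (M : Type*) [TopologicalSpace M] [ChartedSpace E M] : Type _ :=
  (x : M) → TangentSpace 𝓘(ℝ, E) x →L[ℝ] ℝ

/-- A field of endomorphisms of the tangent spaces of `M`. -/
abbrev EndField (E : Type*) [NormedAddCommGroup E] [NormedSpace ℝ E]
    (M : Type*) [TopologicalSpace M] [ChartedSpace E M] : Type _ :=
  (x : M) → TangentSpace 𝓘(ℝ, E) x →L[ℝ] TangentSpace 𝓘(ℝ, E) x

/-- Differentiability at a point of a vector field, as a section of the tangent bundle. -/
def VField.DiffAt [IsManifold 𝓘(ℝ, E) ∞ M] (X : VField E M) (x : M) : Prop :=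
  MDifferentiableAt 𝓘(ℝ, E) (𝓘(ℝ, E).prod 𝓘(ℝ, E))
    (fun y => (⟨y, X y⟩ : TangentBundle 𝓘(ℝ, E) M)) x

/-- The value at `x` of `(dβ)(X, Y, Z)` for a `2`-form `β` and vector fields `X`, `Y`, `Z`:
`X β(Y, Z) - Y β(X, Z) + Z β(X, Y) - β([X, Y], Z) + β([X, Z], Y) - β([Y, Z], X)`. -/
def extDerivTwoForm
    (β : (x : M) → TangentSpace 𝓘(ℝ, E) x → TangentSpace 𝓘(ℝ, E) x → ℝ)
    (X Y Z : VField E M) (x : M) : ℝ :=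
  mvfderiv 𝓘(ℝ, E) (fun y => β y (Y y) (Z y)) x (X x)
    - mvfderiv 𝓘(ℝ, E) (fun y => β y (X y) (Z y)) x (Y x)
    + mvfderiv 𝓘(ℝ, E) (fun y => β y (X y) (Y y)) x (Z x)
    - β x (VectorField.mlieBracket 𝓘(ℝ, E) X Y x) (Z x)
    + β x (VectorField.mlieBracket 𝓘(ℝ, E) X Z x) (Y x)
    - β x (VectorField.mlieBracket 𝓘(ℝ, E) Y Z x) (X x)

/-- The `2`-form `β` is closed on the open set `U`. -/
def IsClosedTwoFormOn [IsManifold 𝓘(ℝ, E) ∞ M]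
    (β : (x : M) → TangentSpace 𝓘(ℝ, E) x → TangentSpace 𝓘(ℝ, E) x → ℝ) (U : Set M) : Prop :=
  ∀ x ∈ U, ∀ X Y Z : VField E M, X.DiffAt x → Y.DiffAt x → Z.DiffAt x →
    extDerivTwoForm β X Y Z x = 0

/-- The field of endomorphisms `J` is a smooth section of the endomorphism bundle. -/
def EndField.IsSmooth [IsManifold 𝓘(ℝ, E) ∞ M] (J : EndField E M) : Prop :=
  ContMDiff 𝓘(ℝ, E) (𝓘(ℝ, E).prod 𝓘(ℝ, E →L[ℝ] E)) ∞
    (fun x => Bundle.TotalSpace.mk' (E →L[ℝ] E)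
      (E := fun x : M => TangentSpace 𝓘(ℝ, E) x →L[ℝ] TangentSpace 𝓘(ℝ, E) x) x (J x))

/-- `J` is an integrable almost complex structure: it is smooth, squares to `-1`, and its
Nijenhuis tensor vanishes. -/
structure IsComplexStructure [IsManifold 𝓘(ℝ, E) ∞ M] (J : EndField E M) : Prop where
  smooth : J.IsSmooth
  sq_eq_neg : ∀ x v, J x (J x v) = -v
  nijenhuis : ∀ (x : M) (X Y : VField E M), X.DiffAt x → Y.DiffAt x →
    VectorField.mlieBracket 𝓘(ℝ, E) (fun y => J y (X y)) (fun y => J y (Y y)) x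
      - J x (VectorField.mlieBracket 𝓘(ℝ, E) (fun y => J y (X y)) Y x)
      - J x (VectorField.mlieBracket 𝓘(ℝ, E) X (fun y => J y (Y y)) x)
      - VectorField.mlieBracket 𝓘(ℝ, E) X Y x = 0

/-- The `1`-form `θ` is the differential of a smooth function on `M`. -/
def IsExactOneForm (θ : OneForm E M) : Prop :=
  ∃ f : M → ℝ, ContMDiff 𝓘(ℝ, E) 𝓘(ℝ, ℝ) ∞ f ∧ ∀ x, mvfderiv 𝓘(ℝ, E) f x = θ x

end Geometry

section Metric

variable {E : Type*} [NormedAddCommGroup E] [NormedSpace ℝ E]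
  {M : Type*} [TopologicalSpace M] [ChartedSpace E M] [IsManifold 𝓘(ℝ, E) ∞ M]
  [Bundle.RiemannianBundle (fun x : M => TangentSpace 𝓘(ℝ, E) x)]

/-- The fundamental form `ω = g(J ·, ·)` of a Hermitian metric. -/
def fundamentalForm (J : EndField E M) (x : M) (u v : TangentSpace 𝓘(ℝ, E) x) : ℝ :=
  inner ℝ (J x u) v

/-- The covariant derivative `D` on the tangent bundle is the Levi-Civita connection: it is
torsion free and compatible with the Riemannian metric. Here `D Y x (X x)` is `(D_X Y)(x)`. -/
structure IsLeviCivita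
    (D : CovariantDerivative 𝓘(ℝ, E) E (fun x : M => TangentSpace 𝓘(ℝ, E) x)) : Prop where
  torsionFree : ∀ (x : M) (X Y : VField E M), X.DiffAt x → Y.DiffAt x →
    D Y x (X x) - D X x (Y x) = VectorField.mlieBracket 𝓘(ℝ, E) X Y x
  metric : ∀ (x : M) (v : TangentSpace 𝓘(ℝ, E) x) (Y Z : VField E M), Y.DiffAt x → Z.DiffAt x →
    mvfderiv 𝓘(ℝ, E) (fun y => inner ℝ (Y y) (Z y)) x v
      = inner ℝ (D Y x v) (Z x) + inner ℝ (Y x) (D Z x v)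

/-- The `1`-form `θ` is parallel for the Levi-Civita connection. -/
def IsParallelOneForm (θ : OneForm E M) : Prop :=
  ∃ D : CovariantDerivative 𝓘(ℝ, E) E (fun x : M => TangentSpace 𝓘(ℝ, E) x),
    IsLeviCivita D ∧
    ∀ (x : M) (v : TangentSpace 𝓘(ℝ, E) x) (Y : VField E M), Y.DiffAt x →
      mvfderiv 𝓘(ℝ, E) (fun y => θ y (Y y)) x v - θ x (D Y x v) = 0

/-- `(M, g, J)` is locally conformally Kähler with Lee form `θ`: the metric `g` is Hermitian for
the complex structure `J`, the real dimension is greater than two, and near each point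
there is a smooth function `f` such that `e^{-f} ω` is closed and `θ = df`. -/
structure IsLCK (J : EndField E M) (θ : OneForm E M) : Prop where
  two_lt_dim : 2 < Module.finrank ℝ E
  complex : IsComplexStructure J
  hermitian : ∀ (x : M) (u v : TangentSpace 𝓘(ℝ, E) x), inner ℝ (J x u) (J x v) = inner ℝ u v
  locallyConformal : ∀ x : M, ∃ U : Set M, IsOpen U ∧ x ∈ U ∧ ∃ f : M → ℝ,
    ContMDiffOn 𝓘(ℝ, E) 𝓘(ℝ, ℝ) ∞ f U ∧
    (∀ y ∈ U, mvfderiv 𝓘(ℝ, E) f y = θ y) ∧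
    IsClosedTwoFormOn (fun y u v => Real.exp (-f y) * fundamentalForm J y u v) U

/-- `(M, g, J)` is a Vaisman manifold with Lee form `θ`: it is strictly locally conformally Kähler
and `θ` is parallel, normalized to have unit length. -/
structure IsVaisman (J : EndField E M) (θ : OneForm E M) : Prop extends IsLCK J θ where
  strict : ¬ IsExactOneForm θ
  parallel : IsParallelOneForm θ
  unit_length : ∀ x : M, ‖θ x‖ = 1

end Metric

section Actions

variable {F : Type*} [NormedAddCommGroup F] [NormedSpace ℝ F]
  {G : Type*} [TopologicalSpace G] [ChartedSpace F G] [Group G]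
  {E : Type*} [NormedAddCommGroup E] [NormedSpace ℝ E]
  {M : Type*} [TopologicalSpace M] [ChartedSpace E M]

/-- A smooth left action of the Lie group `G` on the manifold `M`. -/
structure SmoothAction (F : Type*) [NormedAddCommGroup F] [NormedSpace ℝ F]
    (G : Type*) [TopologicalSpace G] [ChartedSpace F G] [Group G]
    (E : Type*) [NormedAddCommGroup E] [NormedSpace ℝ E]
    (M : Type*) [TopologicalSpace M] [ChartedSpace E M] where
  act : G → M → M
  one_act : ∀ x, act 1 x = x
  mul_act : ∀ a b x, act (a * b) x = act a (act b x)
  smooth : ContMDiff (𝓘(ℝ, F).prod 𝓘(ℝ, E)) 𝓘(ℝ, E) ∞ (fun q : G × M => act q.1 q.2)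

/-- The dual `𝔤*` of the Lie algebra of `G`. -/
abbrev LieDual (F : Type*) [NormedAddCommGroup F] [NormedSpace ℝ F]
    (G : Type*) [TopologicalSpace G] [ChartedSpace F G] [Group G] : Type _ :=
  GroupLieAlgebra 𝓘(ℝ, F) G →L[ℝ] ℝ

/-- The infinitesimal action at `x`, sending `X ∈ 𝔤` to the value at `x` of the fundamental vector
field of `X`: the differential at `1` of the orbit map `a ↦ a • x`. -/
def SmoothAction.fundamental (A : SmoothAction F G E M) (x : M) :
    GroupLieAlgebra 𝓘(ℝ, F) G →L[ℝ] TangentSpace 𝓘(ℝ, E) x :=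
  mfderiv 𝓘(ℝ, F) 𝓘(ℝ, E) (fun a : G => A.act a x) 1

/-- The group acts by automorphisms of the Vaisman structure, that is, by holomorphic
isometries. -/
structure SmoothAction.ByVaismanAutomorphisms [IsManifold 𝓘(ℝ, E) ∞ M]
    [Bundle.RiemannianBundle (fun x : M => TangentSpace 𝓘(ℝ, E) x)]
    (A : SmoothAction F G E M) (J : EndField E M) : Prop where
  isometric : ∀ (a : G) (x : M) (u v : TangentSpace 𝓘(ℝ, E) x),
    inner ℝ (mfderiv 𝓘(ℝ, E) 𝓘(ℝ, E) (A.act a) x u) (mfderiv 𝓘(ℝ, E) 𝓘(ℝ, E) (A.act a) x v)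
      = inner ℝ u v
  holomorphic : ∀ (a : G) (x : M) (v : TangentSpace 𝓘(ℝ, E) x),
    mfderiv 𝓘(ℝ, E) 𝓘(ℝ, E) (A.act a) x (J x v)
      = J (A.act a x) (mfderiv 𝓘(ℝ, E) 𝓘(ℝ, E) (A.act a) x v)

/-- `μ : M → 𝔤*` is a twisted moment map: for each `X ∈ 𝔤` the component `μ^X` is smooth and
`d μ^X - μ^X θ = ω(X̄, ·)`, where `X̄` is the fundamental vector field of `X`. -/
structure IsTwistedMomentMap [IsManifold 𝓘(ℝ, E) ∞ M]
    [Bundle.RiemannianBundle (fun x : M => TangentSpace 𝓘(ℝ, E) x)]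
    (J : EndField E M) (θ : OneForm E M) (A : SmoothAction F G E M) (μ : M → LieDual F G) :
    Prop where
  smooth : ∀ X : GroupLieAlgebra 𝓘(ℝ, F) G, ContMDiff 𝓘(ℝ, E) 𝓘(ℝ, ℝ) ∞ (fun x => μ x X)
  eq : ∀ (X : GroupLieAlgebra 𝓘(ℝ, F) G) (x : M) (v : TangentSpace 𝓘(ℝ, E) x),
    mvfderiv 𝓘(ℝ, E) (fun y => μ y X) x v - μ x X * θ x v
      = fundamentalForm J x (A.fundamental x X) v

end Actions

section Covering

variable {E : Type*} [NormedAddCommGroup E] [NormedSpace ℝ E]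
  {M : Type*} [TopologicalSpace M] [ChartedSpace E M]
  {N : Type*} [TopologicalSpace N] [ChartedSpace E N]

/-- `φ` is a deck transformation of `p : N → M`. -/
def IsDeckTransformation (p : N → M) (φ : N ≃ₜ N) : Prop := ∀ x, p (φ x) = p x

/-- `p : N → M`, together with the primitive `h` of `p^*θ`, is the minimal covering of `M`:
a connected smooth Galois covering on which `θ` becomes the differential of `h`, such that the
homomorphism `φ ↦ h ∘ φ - h ∈ ℝ` on the deck transformation group has trivial kernel. -/
structure IsMinimalCovering (θ : OneForm E M) (p : N → M) (h : N → ℝ) : Prop where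
  connected : ConnectedSpace N
  surjective : Function.Surjective p
  covering : IsCoveringMap p
  localDiffeo : IsLocalDiffeomorph 𝓘(ℝ, E) 𝓘(ℝ, E) ∞ p
  galois : ∀ x y, p x = p y → ∃ φ : N ≃ₜ N, IsDeckTransformation p φ ∧ φ x = y
  primitive_smooth : ContMDiff 𝓘(ℝ, E) 𝓘(ℝ, ℝ) ∞ h
  primitive : ∀ (x : N) (v : TangentSpace 𝓘(ℝ, E) x),
    mvfderiv 𝓘(ℝ, E) h x v = θ (p x) (mfderiv 𝓘(ℝ, E) 𝓘(ℝ, E) p x v)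
  minimal : ∀ φ : N ≃ₜ N, IsDeckTransformation p φ → (∀ x, h (φ x) = h x) → ∀ x, φ x = x

/-- The lift to `N` of a field of endomorphisms along a local diffeomorphism `p : N → M`. -/
def liftEndField (J : EndField E M) (p : N → M) : EndField E N := fun x =>
  (mfderiv 𝓘(ℝ, E) 𝓘(ℝ, E) p x).inverse ∘L (J (p x)) ∘L (mfderiv 𝓘(ℝ, E) 𝓘(ℝ, E) p x)

/-- The `1`-form `d^c h = dh ∘ J`. -/
def dc (J : EndField E N) (h : N → ℝ) : OneForm E N := fun x =>
  (mvfderiv 𝓘(ℝ, E) h x) ∘L (J x)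

variable {K : Type*} [NormedAddCommGroup K] [NormedSpace ℝ K]
  {S : Type*} [TopologicalSpace S] [ChartedSpace K S]

/-- `S`, with its embedding `ι` into the minimal covering, is the hypersurface `h = 0`, which is
the manifold underlying the associated Sasakian manifold. -/
structure IsAssociatedHypersurface (h : N → ℝ) (ι : S → N) : Prop where
  embedding : Manifold.IsSmoothEmbedding 𝓘(ℝ, K) 𝓘(ℝ, E) ∞ ι
  codim_one : Module.finrank ℝ K + 1 = Module.finrank ℝ E
  range_eq : Set.range ι = {x | h x = 0}

/-- The contact form `η = -d^c h` of the associated Sasakian manifold. As `dh` is the lift of `θ`,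
this is the form `g(R, ·)` dual to the Reeb field `R = J θ^♯` in the induced metric. -/
def contactForm (J : EndField E M) (p : N → M) (h : N → ℝ) (ι : S → N) : OneForm K S := fun s =>
  -((dc (liftEndField J p) h (ι s)) ∘L (mfderiv 𝓘(ℝ, K) 𝓘(ℝ, E) ι s))

variable {F : Type*} [NormedAddCommGroup F] [NormedSpace ℝ F]
  {G : Type*} [TopologicalSpace G] [ChartedSpace F G] [Group G]

/-- The action `B` on `S` is induced by the action `A` on `M`: there is a smooth action on the
minimal covering that lifts `A` and restricts to `B`. -/
def IsInducedAction (p : N → M) (ι : S → N) (A : SmoothAction F G E M)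
    (B : SmoothAction F G K S) : Prop :=
  ∃ A' : SmoothAction F G E N, (∀ a x, p (A'.act a x) = A.act a (p x)) ∧
    ∀ a s, ι (B.act a s) = A'.act a (ι s)

/-- The action `B` preserves the contact form `η`. -/
def SmoothAction.IsContact (B : SmoothAction F G K S) (η : OneForm K S) : Prop :=
  ∀ (a : G) (s : S) (v : TangentSpace 𝓘(ℝ, K) s),
    η (B.act a s) (mfderiv 𝓘(ℝ, K) 𝓘(ℝ, K) (B.act a) s v) = η s v

/-- The contact moment map `S → 𝔤*`, `s ↦ (X ↦ η(X̄)(s))`, with `X̄` the fundamental vector field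
on `S`. -/
def contactMomentMap (B : SmoothAction F G K S) (η : OneForm K S) (s : S) : LieDual F G :=
  (η s) ∘L (B.fundamental s)

end Covering

end

end VaismanMoment

open scoped Topology

set_option linter.unusedSectionVars false

/-! Write ξ for the Lee field `sharp θ` and X̄ for a fundamental field. The whole statement rests on
the identity μ^X = -θ(J X̄) on M. Since η is the pullback of -θ ∘ J along p ∘ ι, and p ∘ ι
intertwines an induced action with the given one, this identity says Φ = μ ∘ p ∘ ι
(`contactMomentMap_eq`), so Φ(S) ⊆ μ(M).

To get the identity, evaluate the moment map equation on ξ, where θ(ξ) = 1: it remains to see that k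
= dμ^X(ξ) vanishes (`IsTwistedMomentMap.mvfderiv_sharp_eq_zero`). The field ξ is parallel, ∇_ξ J =
0, and ξ commutes with X̄ because holomorphic isometries preserve θ. Differentiating the moment map
equation along ξ then gives dk = kθ. If k were nonzero somewhere it would vanish nowhere, and log
|k| would be a primitive of θ, which is not exact.

The action lifts because θ(X̄) = 0 (`IsTwistedMomentMap.lee_fundamental_eq_zero`). Invariance of θ
makes θ(X̄) a constant c. If c ≠ 0, the moment map equation on X̄ gives μ^X = 0 wherever μ^X is
critical along an orbit. Orbits are compact, so the extrema of μ^X on each orbit are 0 and μ^X ≡ 0;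
then X̄ = 0, contradicting c ≠ 0. Hence orbits lift to N inside level sets of h. By minimality a
point of N is determined by its images under p and h (`IsMinimalCovering.eq_of_eq`), so the lift
with h fixed is unique; it is an action, and it restricts to S.

For μ(M) ⊆ Φ(S), the field ξ has unit length on a complete manifold, so its integral curves are
defined for all time. Along them μ is constant, and h grows at unit speed on their lifts. Every
point of M therefore flows, with μ unchanged, to the projection of a point of S. -/

namespace VaismanMoment


/-! ### Differential calculus of functions on manifolds. -/

section Calculus

variable {E : Type*} [NormedAddCommGroup E] [NormedSpace ℝ E]
  {M : Type*} [TopologicalSpace M] [ChartedSpace E M]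
  {F : Type*} [NormedAddCommGroup F] [NormedSpace ℝ F]
  {P : Type*} [TopologicalSpace P] [ChartedSpace F P]
  {V : Type*} [NormedAddCommGroup V] [NormedSpace ℝ V]

/-- At the centre of a chart, the derivative is the derivative in that chart. -/
lemma mvfderiv_eq_fderiv_chart {g : M → V} {x : M} (hg : MDifferentiableAt 𝓘(ℝ, E) 𝓘(ℝ, V) g x)
    (v : TangentSpace 𝓘(ℝ, E) x) :
    mvfderiv 𝓘(ℝ, E) g x v
      = fderiv ℝ (g ∘ (extChartAt 𝓘(ℝ, E) x).symm) (extChartAt 𝓘(ℝ, E) x x) v := by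
  rw [hg.mvfderiv]
  simp only [writtenInExtChartAt, extChartAt_model_space_eq_id, modelWithCornersSelf_coe,
    Set.range_id, fderivWithin_univ]
  rfl

/-- The derivative of a function that factors through the chart centred at `x`. -/
lemma mvfderiv_eq_of_eventuallyEq_chart {g : M → V} {x : M} {G : E → V}
    (hg : g =ᶠ[𝓝 x] G ∘ extChartAt 𝓘(ℝ, E) x)
    (hG : DifferentiableAt ℝ G (extChartAt 𝓘(ℝ, E) x x)) (v : TangentSpace 𝓘(ℝ, E) x)
    [IsManifold 𝓘(ℝ, E) 1 M] :
    MDifferentiableAt 𝓘(ℝ, E) 𝓘(ℝ, V) g x ∧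
    mvfderiv 𝓘(ℝ, E) g x v = fderiv ℝ G (extChartAt 𝓘(ℝ, E) x x) v := by
  have h1 : MDifferentiableAt 𝓘(ℝ, E) 𝓘(ℝ, V) g x := by
    refine MDifferentiableAt.congr_of_eventuallyEq ?_ hg
    exact hG.mdifferentiableAt.comp x (mdifferentiableAt_extChartAt (mem_chart_source _ _))
  refine ⟨h1, ?_⟩
  rw [mvfderiv_eq_fderiv_chart h1]
  have : (g ∘ (extChartAt 𝓘(ℝ, E) x).symm) =ᶠ[𝓝 (extChartAt 𝓘(ℝ, E) x x)] G := by
    have hc : Filter.Tendsto (extChartAt 𝓘(ℝ, E) x).symm (𝓝 (extChartAt 𝓘(ℝ, E) x x)) (𝓝 x) := by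
      simpa [ContinuousAt] using continuousAt_extChartAt_symm (I := 𝓘(ℝ, E)) x
    filter_upwards [hc.eventually hg, extChartAt_target_mem_nhds (I := 𝓘(ℝ, E)) x] with z hz hz'
    simp only [Function.comp_apply] at hz ⊢
    rw [hz, (extChartAt 𝓘(ℝ, E) x).right_inv hz']
  rw [this.fderiv_eq]

/-- Each point has arbitrarily small open neighbourhoods on which functions with vanishing
derivative are constant. -/
lemma exists_nhds_eqOn_of_mvfderiv_eq_zero (V : Type*) [NormedAddCommGroup V] [NormedSpace ℝ V]
    [IsManifold 𝓘(ℝ, E) 1 M] {x : M} {U : Set M} (hU : U ∈ 𝓝 x) :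
    ∃ W ⊆ U, IsOpen W ∧ x ∈ W ∧ ∀ u : M → V,
      (∀ y ∈ W, MDifferentiableAt 𝓘(ℝ, E) 𝓘(ℝ, V) u y ∧ ∀ v, mvfderiv 𝓘(ℝ, E) u y v = 0) →
      ∀ y ∈ W, u y = u x := by
  set φ := extChartAt 𝓘(ℝ, E) x with hφ
  have hx : x ∈ φ.source := mem_extChartAt_source x
  have h1 : φ.symm ⁻¹' U ∩ φ.target ∈ 𝓝 (φ x) := by
    refine Filter.inter_mem ?_ (extChartAt_target_mem_nhds (I := 𝓘(ℝ, E)) x)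
    apply (continuousAt_extChartAt_symm (I := 𝓘(ℝ, E)) x).preimage_mem_nhds
    rwa [extChartAt_to_inv]
  obtain ⟨r, hr, hball⟩ := Metric.mem_nhds_iff.1 h1
  -- A chart ball is convex. It is fixed before `u`, so a single neighbourhood serves a whole family
  -- of functions, such as one indexed by group elements.
  refine ⟨φ.source ∩ φ ⁻¹' Metric.ball (φ x) r, ?_, ?_, ⟨hx, Metric.mem_ball_self hr⟩, ?_⟩
  · rintro y ⟨hy, hy'⟩
    have := (hball hy').1
    rwa [Set.mem_preimage, φ.left_inv hy] at this
  · exact (continuousOn_extChartAt x).isOpen_inter_preimage (isOpen_extChartAt_source x)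
      Metric.isOpen_ball
  · rintro u hu y ⟨hy, hy'⟩
    have key : ∀ z ∈ Metric.ball (φ x) r, HasFDerivAt (u ∘ φ.symm) (0 : E →L[ℝ] V) z := by
      intro z hz
      have hzt := (hball hz).2
      have hd := hu (φ.symm z) ⟨φ.map_target hzt, by rwa [Set.mem_preimage, φ.right_inv hzt]⟩
      have h2 : mfderiv 𝓘(ℝ, E) 𝓘(ℝ, V) u (φ.symm z) = 0 := by
        ext v; exact hd.2 v
      have h3 : MDifferentiableAt 𝓘(ℝ, E) 𝓘(ℝ, E) φ.symm z :=
        ((contMDiffOn_extChartAt_symm (n := 1) x).contMDiffAt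
          ((isOpen_extChartAt_target x).mem_nhds hzt)).mdifferentiableAt one_ne_zero
      have h4 := (hd.1.hasMFDerivAt.comp z h3.hasMFDerivAt)
      rw [h2] at h4
      have h5 := h4.hasFDerivAt
      exact h5.congr_fderiv (by ext v; rfl)
    have := (convex_ball (φ x) r).is_const_of_fderivWithin_eq_zero (𝕜 := ℝ) (f := u ∘ φ.symm)
      (fun z hz => (key z hz).differentiableAt.differentiableWithinAt)
      (fun z hz => by
        rw [fderivWithin_of_isOpen Metric.isOpen_ball hz, (key z hz).fderiv])
      hy' (Metric.mem_ball_self hr)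
    simpa [φ.left_inv hy, φ.left_inv hx] using this

/-- Chain rule for the composition of a function on a manifold with a function of a real
variable. -/
lemma mvfderiv_real_comp {f : M → ℝ} {x : M} {r : ℝ → ℝ} {c : ℝ} (hr : HasDerivAt r c (f x))
    (hf : MDifferentiableAt 𝓘(ℝ, E) 𝓘(ℝ, ℝ) f x) (v : TangentSpace 𝓘(ℝ, E) x) :
    MDifferentiableAt 𝓘(ℝ, E) 𝓘(ℝ, ℝ) (fun y => r (f y)) x ∧
    mvfderiv 𝓘(ℝ, E) (fun y => r (f y)) x v = c * mvfderiv 𝓘(ℝ, E) f x v := by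
  have h := hr.hasFDerivAt.hasMFDerivAt.comp x hf.hasMFDerivAt
  refine ⟨h.mdifferentiableAt, ?_⟩
  have h1 : mvfderiv 𝓘(ℝ, E) (fun y => r (f y)) x v
      = ContinuousLinearMap.toSpanSingleton ℝ c (mvfderiv 𝓘(ℝ, E) f x v) := by
    unfold mvfderiv
    erw [h.mfderiv]
    rfl
  rw [h1, ContinuousLinearMap.toSpanSingleton_apply, smul_eq_mul, mul_comm]

/-- Symmetry of mixed second derivatives of a function on a product of manifolds. -/
lemma mvfderiv_mvfderiv_comm [IsManifold 𝓘(ℝ, E) 2 M] [IsManifold 𝓘(ℝ, F) 2 P]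
    {w : P × M → V} {a : P} {x : M}
    (hw : ContMDiffAt (𝓘(ℝ, F).prod 𝓘(ℝ, E)) 𝓘(ℝ, V) 2 w (a, x))
    (X : F) (v : E) :
    mvfderiv 𝓘(ℝ, F) (fun b => mvfderiv 𝓘(ℝ, E) (fun y => w (b, y)) x (v : TangentSpace 𝓘(ℝ, E) x)) a (X : TangentSpace 𝓘(ℝ, F) a)
      = mvfderiv 𝓘(ℝ, E) (fun y => mvfderiv 𝓘(ℝ, F) (fun b => w (b, y)) a X) x v := by
  have : IsManifold 𝓘(ℝ, E) 1 M := .of_le (n := 2) (by norm_num)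
  have : IsManifold 𝓘(ℝ, F) 1 P := .of_le (n := 2) (by norm_num)
  set φ := extChartAt 𝓘(ℝ, F) a with hφ
  set ψ := extChartAt 𝓘(ℝ, E) x with hψ
  set W : F × E → V := fun z => w (φ.symm z.1, ψ.symm z.2) with hW
  have hWs : ContDiffAt ℝ 2 W (φ a, ψ x) := by
    have h1 : ContMDiffAt 𝓘(ℝ, F) 𝓘(ℝ, F) 2 φ.symm (φ a) :=
      (contMDiffOn_extChartAt_symm (n := 2) a).contMDiffAt (extChartAt_target_mem_nhds a)
    have h2 : ContMDiffAt 𝓘(ℝ, E) 𝓘(ℝ, E) 2 ψ.symm (ψ x) :=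
      (contMDiffOn_extChartAt_symm (n := 2) x).contMDiffAt (extChartAt_target_mem_nhds x)
    have h3 : ContMDiffAt (𝓘(ℝ, F).prod 𝓘(ℝ, E)) (𝓘(ℝ, F).prod 𝓘(ℝ, E)) 2
        (Prod.map φ.symm ψ.symm) (φ a, ψ x) := h1.prodMap h2
    have h4 : ContMDiffAt (𝓘(ℝ, F).prod 𝓘(ℝ, E)) 𝓘(ℝ, V) 2 (w ∘ (Prod.map φ.symm ψ.symm))
        (φ a, ψ x) := by
      refine ContMDiffAt.comp _ ?_ h3
      simpa [φ, ψ] using hw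
    rw [← modelWithCornersSelf_prod, chartedSpaceSelf_prod] at h4
    exact h4.contDiffAt
  have hev : ∀ᶠ z in 𝓝 (φ a, ψ x), DifferentiableAt ℝ W z := by
    filter_upwards [hWs.eventually (by simp)] with z hz
    exact hz.differentiableAt (by norm_num)
  have hDW : DifferentiableAt ℝ (fderiv ℝ W) (φ a, ψ x) :=
    (hWs.fderiv_right (m := 1) (by norm_num)).differentiableAt (by norm_num)
  have hsymm : IsSymmSndFDerivAt ℝ W (φ a, ψ x) := hWs.isSymmSndFDerivAt (by simp)
  -- In the two charts both inner derivatives become partial derivatives of `W`, so the claim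
  -- reduces to symmetry of the second derivative of `W`.
  have hl : (fun b => mvfderiv 𝓘(ℝ, E) (fun y => w (b, y)) x v)
      =ᶠ[𝓝 a] (fun s => fderiv ℝ W (s, ψ x) (0, v)) ∘ φ := by
    have hc : Filter.Tendsto (fun b => (φ b, ψ x)) (𝓝 a) (𝓝 (φ a, ψ x)) :=
      (continuousAt_extChartAt a).prodMk_nhds tendsto_const_nhds
    filter_upwards [hc.eventually hev, extChartAt_source_mem_nhds (I := 𝓘(ℝ, F)) a] with b hb hb'
    have hG : HasFDerivAt (fun t => W (φ b, t))
        ((fderiv ℝ W (φ b, ψ x)).comp (ContinuousLinearMap.inr ℝ F E)) (ψ x) :=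
      hb.hasFDerivAt.comp (ψ x) (hasFDerivAt_prodMk_right (φ b) (ψ x))
    rw [(mvfderiv_eq_of_eventuallyEq_chart (G := fun t => W (φ b, t)) ?_
      hG.differentiableAt v).2, hG.fderiv]
    · rfl
    · filter_upwards [extChartAt_source_mem_nhds (I := 𝓘(ℝ, E)) x] with y hy
      simp only [W, Function.comp_apply]
      rw [ψ.left_inv hy, φ.left_inv hb']
  have hr : (fun y => mvfderiv 𝓘(ℝ, F) (fun b => w (b, y)) a X)
      =ᶠ[𝓝 x] (fun t => fderiv ℝ W (φ a, t) (X, 0)) ∘ ψ := by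
    have hc : Filter.Tendsto (fun y => (φ a, ψ y)) (𝓝 x) (𝓝 (φ a, ψ x)) :=
      tendsto_const_nhds.prodMk_nhds (continuousAt_extChartAt x)
    filter_upwards [hc.eventually hev, extChartAt_source_mem_nhds (I := 𝓘(ℝ, E)) x] with y hy hy'
    have hG : HasFDerivAt (fun s => W (s, ψ y))
        ((fderiv ℝ W (φ a, ψ y)).comp (ContinuousLinearMap.inl ℝ F E)) (φ a) :=
      HasFDerivAt.comp (g := W) (f := fun s => (s, ψ y)) (φ a) hy.hasFDerivAt
        (hasFDerivAt_prodMk_left (φ a) (ψ y))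
    rw [(mvfderiv_eq_of_eventuallyEq_chart (G := fun s => W (s, ψ y)) ?_
      hG.differentiableAt X).2, hG.fderiv]
    · rfl
    · filter_upwards [extChartAt_source_mem_nhds (I := 𝓘(ℝ, F)) a] with b hb
      simp only [W, Function.comp_apply]
      rw [φ.left_inv hb, ψ.left_inv hy']
  have hGl : HasFDerivAt (fun s => fderiv ℝ W (s, ψ x) (0, v))
      (((ContinuousLinearMap.apply ℝ V ((0 : F), (v : E))).comp
        (fderiv ℝ (fderiv ℝ W) (φ a, ψ x))).comp (ContinuousLinearMap.inl ℝ F E)) (φ a) :=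
    HasFDerivAt.comp (g := fun z => fderiv ℝ W z ((0 : F), v)) (f := fun s => (s, ψ x)) (φ a)
      ((ContinuousLinearMap.apply ℝ V ((0 : F), v)).hasFDerivAt.comp _ hDW.hasFDerivAt)
      (hasFDerivAt_prodMk_left (φ a) (ψ x))
  have hGr : HasFDerivAt (fun t => fderiv ℝ W (φ a, t) (X, 0))
      (((ContinuousLinearMap.apply ℝ V ((X : F), (0 : E))).comp
        (fderiv ℝ (fderiv ℝ W) (φ a, ψ x))).comp (ContinuousLinearMap.inr ℝ F E)) (ψ x) :=
    HasFDerivAt.comp (g := fun z => fderiv ℝ W z (X, (0 : E))) (f := fun t => (φ a, t)) (ψ x)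
      ((ContinuousLinearMap.apply ℝ V (X, (0 : E))).hasFDerivAt.comp _ hDW.hasFDerivAt)
      (hasFDerivAt_prodMk_right (φ a) (ψ x))
  rw [(mvfderiv_eq_of_eventuallyEq_chart hl hGl.differentiableAt X).2,
    (mvfderiv_eq_of_eventuallyEq_chart hr hGr.differentiableAt v).2, hGl.fderiv, hGr.fderiv]
  exact hsymm _ _

/-- The Lie bracket acts on functions as the commutator of derivations. -/
lemma mvfderiv_mlieBracket [IsManifold 𝓘(ℝ, E) ∞ M] [CompleteSpace E]
    {g : M → V} {x : M} (hg : ContMDiffAt 𝓘(ℝ, E) 𝓘(ℝ, V) 2 g x)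
    {X Y : VField E M} (hX : X.DiffAt x) (hY : Y.DiffAt x) :
    mvfderiv 𝓘(ℝ, E) g x (VectorField.mlieBracket 𝓘(ℝ, E) X Y x)
      = mvfderiv 𝓘(ℝ, E) (fun y => mvfderiv 𝓘(ℝ, E) g y (Y y)) x (X x)
        - mvfderiv 𝓘(ℝ, E) (fun y => mvfderiv 𝓘(ℝ, E) g y (X y)) x (Y x) := by
  have : IsManifold 𝓘(ℝ, E) 2 M := inferInstance
  have : IsManifold 𝓘(ℝ, E) 1 M := inferInstance
  set φ := extChartAt 𝓘(ℝ, E) x with hφ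
  set ĝ : E → V := g ∘ φ.symm with hĝ
  have hĝs : ContDiffAt ℝ 2 ĝ (φ x) := by
    have h1 : ContMDiffAt 𝓘(ℝ, E) 𝓘(ℝ, E) 2 φ.symm (φ x) :=
      (contMDiffOn_extChartAt_symm (n := 2) x).contMDiffAt (extChartAt_target_mem_nhds x)
    refine (ContMDiffAt.comp (φ x) (g := g) ?_ h1).contDiffAt
    simpa [φ] using hg
  have hD : DifferentiableAt ℝ (fderiv ℝ ĝ) (φ x) :=
    (hĝs.fderiv_right (m := 1) (by norm_num)).differentiableAt (by norm_num)
  have hsymm : IsSymmSndFDerivAt ℝ ĝ (φ x) := hĝs.isSymmSndFDerivAt (by simp)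
  have hev : ∀ᶠ z in 𝓝 (φ x), DifferentiableAt ℝ ĝ z := by
    filter_upwards [hĝs.eventually (by simp)] with z hz
    exact hz.differentiableAt (by norm_num)
  -- the representative of a vector field in the chart
  let R : VField E M → E → E := fun Z =>
    VectorField.mpullbackWithin 𝓘(ℝ, E) 𝓘(ℝ, E) φ.symm Z Set.univ
  have hR : ∀ Z : VField E M, Z.DiffAt x → DifferentiableAt ℝ (R Z) (φ x) := by
    intro Z hZ
    have hZ' := MDifferentiableAt.mdifferentiableWithinAt (s := Set.univ) hZ
    have := hZ'.differentiableWithinAt_mpullbackWithin_vectorField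
    rw [Set.preimage_univ, Set.univ_inter, modelWithCornersSelf_coe, Set.range_id] at this
    exact differentiableWithinAt_univ.1 this
  have hval : ∀ Z : VField E M, ∀ y ∈ φ.source, mfderiv 𝓘(ℝ, E) 𝓘(ℝ, E) φ y (Z y) = R Z (φ y) := by
    intro Z y hy
    have h1 := mfderivWithin_extChartAt_symm_comp_mfderiv_extChartAt' (I := 𝓘(ℝ, E)) hy
    have h2 := isInvertible_mfderivWithin_extChartAt_symm (I := 𝓘(ℝ, E)) (φ.map_source hy)
    rw [modelWithCornersSelf_coe, Set.range_id] at h1 h2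
    simp only [R, VectorField.mpullbackWithin_apply]
    obtain ⟨e, he⟩ := h2
    rw [← hφ] at h1
    rw [← he] at h1 ⊢
    rw [ContinuousLinearMap.inverse_equiv]
    have h3 : ∀ v, e (mfderiv 𝓘(ℝ, E) 𝓘(ℝ, E) φ y v) = v := fun v => DFunLike.congr_fun h1 v
    have h4 : (Z (φ.symm (φ y)) : E) = Z y := by rw [φ.left_inv hy]
    have h5 : (e.symm (Z (φ.symm (φ y))) : E) = mfderiv 𝓘(ℝ, E) 𝓘(ℝ, E) φ y (Z y) := by
      apply e.injective
      rw [h3]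
      exact (e.apply_symm_apply _).trans h4
    exact h5.symm
  have hder : ∀ Z : VField E M, (fun y => mvfderiv 𝓘(ℝ, E) g y (Z y))
      =ᶠ[𝓝 x] (fun z => fderiv ℝ ĝ z (R Z z)) ∘ φ := by
    intro Z
    filter_upwards [(continuousAt_extChartAt (I := 𝓘(ℝ, E)) x).eventually hev,
      (isOpen_extChartAt_source (I := 𝓘(ℝ, E)) x).mem_nhds (mem_extChartAt_source x)] with y hy hy'
    have hgy : g =ᶠ[𝓝 y] ĝ ∘ φ := by
      filter_upwards [(isOpen_extChartAt_source (I := 𝓘(ℝ, E)) x).mem_nhds hy'] with z hz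
      simp [ĝ, φ.left_inv hz]
    have h1 : MDifferentiableAt 𝓘(ℝ, E) 𝓘(ℝ, E) φ y :=
      mdifferentiableAt_extChartAt (by simpa [φ] using hy')
    have h2 := (DifferentiableAt.hasFDerivAt hy).hasMFDerivAt.comp y h1.hasMFDerivAt
    have h3 := (h2.congr_of_eventuallyEq hgy).mfderiv
    have h4 : mvfderiv 𝓘(ℝ, E) g y (Z y) = fderiv ℝ ĝ (φ y) (mfderiv 𝓘(ℝ, E) 𝓘(ℝ, E) φ y (Z y)) := by
      unfold mvfderiv
      rw [h3]
      rfl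
    rw [h4, hval Z y hy']
    rfl
  have hG : ∀ Z : VField E M, Z.DiffAt x →
      HasFDerivAt (fun z => fderiv ℝ ĝ z (R Z z))
        ((fderiv ℝ ĝ (φ x)).comp (fderiv ℝ (R Z) (φ x))
          + (fderiv ℝ (fderiv ℝ ĝ) (φ x)).flip (R Z (φ x))) (φ x) := fun Z hZ =>
    hD.hasFDerivAt.clm_apply (hR Z hZ).hasFDerivAt
  -- The tangent space at `x` is identified with the model space by the preferred chart at `x`, so
  -- that chart has identity derivative there.
  have hself : ∀ v : TangentSpace 𝓘(ℝ, E) x, mfderiv 𝓘(ℝ, E) 𝓘(ℝ, E) φ x v = v := by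
    intro v
    have := mvfderiv_eq_of_eventuallyEq_chart (g := φ) (G := id) (x := x) (by rfl)
      differentiableAt_id v
    rw [fderiv_id] at this
    exact this.2
  have hRx : ∀ Z : VField E M, R Z (φ x) = Z x := fun Z => by
    rw [← hval Z x (mem_extChartAt_source x), hself]
  have hgx : MDifferentiableAt 𝓘(ℝ, E) 𝓘(ℝ, V) g x := hg.mdifferentiableAt (by norm_num)
  rw [(mvfderiv_eq_of_eventuallyEq_chart (hder Y) (hG Y hY).differentiableAt _).2,
    (mvfderiv_eq_of_eventuallyEq_chart (hder X) (hG X hX).differentiableAt _).2,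
    (hG X hX).fderiv, (hG Y hY).fderiv, mvfderiv_eq_fderiv_chart hgx]
  have hbr : VectorField.mlieBracket 𝓘(ℝ, E) X Y x
      = fderiv ℝ (R Y) (φ x) (X x) - fderiv ℝ (R X) (φ x) (Y x) := by
    have h1 : VectorField.mlieBracket 𝓘(ℝ, E) X Y x
        = (ContinuousLinearMap.inverse (mfderiv 𝓘(ℝ, E) 𝓘(ℝ, E) φ x : E →L[ℝ] E) : E →L[ℝ] E)
            (VectorField.lieBracketWithin ℝ (R X) (R Y) Set.univ (φ x)) := by
      rw [VectorField.mlieBracket, VectorField.mlieBracketWithin_apply, Set.preimage_univ,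
        Set.univ_inter]
      simp only [modelWithCornersSelf_coe, Set.range_id]
      rfl
    have h2 : (mfderiv 𝓘(ℝ, E) 𝓘(ℝ, E) φ x : E →L[ℝ] E) = ContinuousLinearMap.id ℝ E :=
      ContinuousLinearMap.ext hself
    rw [h1, h2, VectorField.lieBracketWithin_univ, ContinuousLinearMap.inverse_id]
    change VectorField.lieBracket ℝ (R X) (R Y) (φ x) = _
    rw [VectorField.lieBracket, hRx X, hRx Y]
  rw [hbr]
  have hs : fderiv ℝ (fderiv ℝ ĝ) (φ x) (X x) (Y x) = fderiv ℝ (fderiv ℝ ĝ) (φ x) (Y x) (X x) :=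
    hsymm (X x) (Y x)
  change fderiv ℝ ĝ (φ x) (fderiv ℝ (R Y) (φ x) (X x) - fderiv ℝ (R X) (φ x) (Y x))
    = (fderiv ℝ ĝ (φ x) (fderiv ℝ (R Y) (φ x) (X x))
        + fderiv ℝ (fderiv ℝ ĝ) (φ x) (X x) (R Y (φ x)))
      - (fderiv ℝ ĝ (φ x) (fderiv ℝ (R X) (φ x) (Y x))
        + fderiv ℝ (fderiv ℝ ĝ) (φ x) (Y x) (R X (φ x)))
  rw [map_sub, hRx X, hRx Y, hs]
  abel

end Calculus


/-! ### Smooth vector fields and one-forms. -/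

section Fields

variable {E : Type*} [NormedAddCommGroup E] [NormedSpace ℝ E]
  {M : Type*} [TopologicalSpace M] [ChartedSpace E M] [IsManifold 𝓘(ℝ, E) ∞ M]

/-- Smoothness at a point of a vector field, as a section of the tangent bundle. -/
def VField.SmoothAt (X : VField E M) (x : M) : Prop :=
  ContMDiffAt 𝓘(ℝ, E) (𝓘(ℝ, E).prod 𝓘(ℝ, E)) ∞
    (fun y => (⟨y, X y⟩ : TangentBundle 𝓘(ℝ, E) M)) x

/-- Smoothness at a point of a `1`-form, as a section of the cotangent bundle. -/
def OneForm.SmoothAt (θ : OneForm E M) (x : M) : Prop :=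
  ContMDiffAt 𝓘(ℝ, E) (𝓘(ℝ, E).prod 𝓘(ℝ, E →L[ℝ] ℝ)) ∞
    (fun y => Bundle.TotalSpace.mk' (E →L[ℝ] ℝ)
      (E := fun y : M => TangentSpace 𝓘(ℝ, E) y →L[ℝ] ℝ) y (θ y)) x

lemma VField.SmoothAt.diffAt {X : VField E M} {x : M} (hX : X.SmoothAt x) : X.DiffAt x :=
  ContMDiffAt.mdifferentiableAt hX (by simp)

/-- Every tangent vector extends to a vector field that is smooth near its base point. -/
lemma exists_smoothAt_eq (x : M) (v : TangentSpace 𝓘(ℝ, E) x) :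
    ∃ X : VField E M, X.SmoothAt x ∧ X x = v :=
  ⟨FiberBundle.extend E v, FiberBundle.contMDiffAt_extend 𝓘(ℝ, E) E v,
    FiberBundle.extend_apply_self E v⟩

lemma EndField.IsSmooth.smoothAt {J : EndField E M} (hJ : J.IsSmooth) {X : VField E M} {x : M}
    (hX : X.SmoothAt x) : VField.SmoothAt (fun y => J y (X y)) x :=
  ContMDiffAt.clm_bundle_apply (hJ x) hX

lemma EndField.IsSmooth.diffAt {J : EndField E M} (hJ : J.IsSmooth) {X : VField E M} {x : M}
    (hX : X.DiffAt x) : VField.DiffAt (fun y => J y (X y)) x :=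
  MDifferentiableAt.clm_bundle_apply ((hJ x).mdifferentiableAt (by simp)) hX

/-- A one-form is a section of the bundle of homomorphisms into the trivial line bundle; apply it
there and keep the fibre component. -/
lemma OneForm.SmoothAt.mdifferentiableAt {θ : OneForm E M} {X : VField E M} {x : M}
    (hθ : θ.SmoothAt x) (hX : X.DiffAt x) :
    MDifferentiableAt 𝓘(ℝ, E) 𝓘(ℝ, ℝ) (fun y => θ y (X y)) x := by
  have h : MDifferentiableAt 𝓘(ℝ, E) (𝓘(ℝ, E).prod 𝓘(ℝ, ℝ))
      (fun y => Bundle.TotalSpace.mk' ℝ (E := Bundle.Trivial M ℝ) y (θ y (X y))) x :=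
    MDifferentiableAt.clm_bundle_apply (E₂ := Bundle.Trivial M ℝ)
      (ContMDiffAt.mdifferentiableAt hθ (by simp)) hX
  simp only [mdifferentiableAt_totalSpace] at h
  exact h.2

lemma OneForm.SmoothAt.contMDiffAt {θ : OneForm E M} {X : VField E M} {x : M}
    (hθ : θ.SmoothAt x) (hX : X.SmoothAt x) :
    ContMDiffAt 𝓘(ℝ, E) 𝓘(ℝ, ℝ) ∞ (fun y => θ y (X y)) x := by
  have h : ContMDiffAt 𝓘(ℝ, E) (𝓘(ℝ, E).prod 𝓘(ℝ, ℝ)) ∞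
      (fun y => Bundle.TotalSpace.mk' ℝ (E := Bundle.Trivial M ℝ) y (θ y (X y))) x :=
    ContMDiffAt.clm_bundle_apply (E₂ := Bundle.Trivial M ℝ) hθ hX
  simp only [Bundle.contMDiffAt_totalSpace] at h
  exact h.2

/-- A `1`-form that is locally the differential of a smooth function is smooth. -/
lemma OneForm.smoothAt_of_eventually_mvfderiv {θ : OneForm E M} {f : M → ℝ} {x : M}
    (hf : ContMDiffAt 𝓘(ℝ, E) 𝓘(ℝ, ℝ) ∞ f x)
    (h : ∀ᶠ y in 𝓝 x, mvfderiv 𝓘(ℝ, E) f y = θ y) : θ.SmoothAt x := by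
  have h1 := hf.mfderiv_const (m := ∞) (by simp)
  unfold OneForm.SmoothAt
  rw [contMDiffAt_hom_bundle (E₂ := Bundle.Trivial M ℝ)]
  refine ⟨contMDiffAt_id, h1.congr_of_eventuallyEq ?_⟩
  filter_upwards [h, (trivializationAt E (TangentSpace 𝓘(ℝ, E)) x).open_baseSet.mem_nhds
    (FiberBundle.mem_baseSet_trivializationAt' x)] with y hy hy'
  unfold inTangentCoordinates
  ext v
  simp only [← hy]
  rw [ContinuousLinearMap.inCoordinates_eq hy' (by simp),
    ContinuousLinearMap.inCoordinates_eq (by exact hy')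
      (by rw [TangentBundle.trivializationAt_baseSet]; exact Set.mem_univ _)]
  simp [mvfderiv]
  rfl

/-- The scalar product of two differentiable vector fields is differentiable. -/
lemma VField.DiffAt.inner [Bundle.RiemannianBundle (fun x : M => TangentSpace 𝓘(ℝ, E) x)]
    [IsContMDiffRiemannianBundle 𝓘(ℝ, E) ∞ E (fun x : M => TangentSpace 𝓘(ℝ, E) x)]
    {X Y : VField E M} {x : M} (hX : X.DiffAt x) (hY : Y.DiffAt x) :
    MDifferentiableAt 𝓘(ℝ, E) 𝓘(ℝ, ℝ) (fun y => inner ℝ (X y) (Y y)) x :=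
  MDifferentiableAt.inner_bundle hX hY

end Fields

section Separation

variable {E : Type*} [NormedAddCommGroup E] [NormedSpace ℝ E]
  {M : Type*} [TopologicalSpace M] [ChartedSpace E M] [IsManifold 𝓘(ℝ, E) ∞ M]

/-- Smooth functions separate tangent vectors. -/
lemma eq_zero_of_forall_mvfderiv_eq_zero {x : M} {w : TangentSpace 𝓘(ℝ, E) x}
    (h : ∀ u : M → ℝ, ContMDiffAt 𝓘(ℝ, E) 𝓘(ℝ, ℝ) ∞ u x → mvfderiv 𝓘(ℝ, E) u x w = 0) :
    w = 0 := by
  have : IsManifold 𝓘(ℝ, E) 1 M := inferInstance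
  refine SeparatingDual.eq_zero_of_forall_dual_eq_zero (R := ℝ) (V := E) fun l => ?_
  -- Continuous linear functionals read in the chart at `x` already suffice as test functions.
  have h1 : ContMDiffAt 𝓘(ℝ, E) 𝓘(ℝ, ℝ) ∞ (l ∘ extChartAt 𝓘(ℝ, E) x) x :=
    l.contDiff.contMDiff.contMDiffAt.comp x contMDiffAt_extChartAt
  have h2 := (mvfderiv_eq_of_eventuallyEq_chart (g := l ∘ extChartAt 𝓘(ℝ, E) x) (G := l) (x := x)
    (by rfl) l.differentiableAt w).2
  rw [h _ h1, l.fderiv] at h2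
  exact h2.symm

end Separation

/-! ### The metric dual of a one-form. -/

section Sharp

variable {E : Type*} [NormedAddCommGroup E] [NormedSpace ℝ E] [FiniteDimensional ℝ E]
  {M : Type*} [TopologicalSpace M] [ChartedSpace E M] [IsManifold 𝓘(ℝ, E) ∞ M]
  [Bundle.RiemannianBundle (fun x : M => TangentSpace 𝓘(ℝ, E) x)]

instance finiteDimensional_tangentSpace (x : M) : FiniteDimensional ℝ (TangentSpace 𝓘(ℝ, E) x) :=
  inferInstanceAs (FiniteDimensional ℝ E)

instance completeSpace_tangentSpace (x : M) : CompleteSpace (TangentSpace 𝓘(ℝ, E) x) :=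
  FiniteDimensional.complete ℝ _

/-- The vector field dual to a `1`-form with respect to a Riemannian metric. -/
noncomputable def sharp (θ : OneForm E M) : VField E M := fun x =>
  (InnerProductSpace.toDual ℝ (TangentSpace 𝓘(ℝ, E) x)).symm (θ x)

lemma inner_sharp (θ : OneForm E M) (x : M) (v : TangentSpace 𝓘(ℝ, E) x) :
    inner ℝ (sharp θ x) v = θ x v :=
  InnerProductSpace.toDual_symm_apply

lemma norm_sharp (θ : OneForm E M) (x : M) : ‖sharp θ x‖ = ‖θ x‖ :=
  (InnerProductSpace.toDual ℝ (TangentSpace 𝓘(ℝ, E) x)).symm.norm_map (θ x)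

/-- The metric is a smooth bundle isomorphism from the tangent to the cotangent bundle, and
inversion of operators is smooth; read in trivializations, `sharp` applies the inverse operator. -/
lemma sharp_smoothAt [IsContMDiffRiemannianBundle 𝓘(ℝ, E) ∞ E (fun x : M => TangentSpace 𝓘(ℝ, E) x)]
    {θ : OneForm E M} {x : M} (hθ : θ.SmoothAt x) : (sharp θ).SmoothAt x := by
  obtain ⟨g, hg, hginner⟩ := IsContMDiffRiemannianBundle.exists_contMDiff
    (IB := 𝓘(ℝ, E)) (n := ∞) (F := E) (E := fun x : M => TangentSpace 𝓘(ℝ, E) x)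
  have hinv : ∀ y, (g y).IsInvertible := fun y => by
    refine ⟨(InnerProductSpace.toDual ℝ (TangentSpace 𝓘(ℝ, E) y)).toContinuousLinearEquiv, ?_⟩
    ext v w
    exact (hginner y v w)
  have hval : ∀ y, sharp θ y = (g y).inverse (θ y) := fun y => by
    obtain ⟨e, he⟩ := hinv y
    rw [← he, ContinuousLinearMap.inverse_equiv]
    have : e (sharp θ y) = θ y := by
      ext w
      have : e (sharp θ y) = g y (sharp θ y) := by rw [← he]; rfl
      rw [this, ← hginner, inner_sharp]
    exact (e.symm_apply_eq.2 this.symm).symm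
  have hfun : sharp θ = fun y => (g y).inverse (θ y) := funext hval
  rw [hfun]
  refine ContMDiffAt.clm_apply_of_inCoordinates (b₁ := id) (b₂ := id)
    (E₁ := fun y : M => TangentSpace 𝓘(ℝ, E) y →L[ℝ] ℝ) (E₂ := fun y : M => TangentSpace 𝓘(ℝ, E) y)
    (F₁ := E →L[ℝ] ℝ) (F₂ := E) (ϕ := fun y => (g y).inverse) (v := θ) ?_ hθ contMDiffAt_id
  have h1 := ((contMDiffAt_hom_bundle (E₂ := fun y : M => TangentSpace 𝓘(ℝ, E) y →L[ℝ] ℝ)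
    (F₂ := E →L[ℝ] ℝ) _).1 (hg x)).2
  have h2 : ContDiffAt ℝ ∞ (ContinuousLinearMap.inverse : (E →L[ℝ] E →L[ℝ] ℝ) → _)
      (ContinuousLinearMap.inCoordinates E (TangentSpace 𝓘(ℝ, E)) (E →L[ℝ] ℝ)
        (fun y : M => TangentSpace 𝓘(ℝ, E) y →L[ℝ] ℝ) x x x x (g x)) := by
    apply ContinuousLinearMap.IsInvertible.contDiffAt_map_inverse
    rw [ContinuousLinearMap.inCoordinates_eq (FiberBundle.mem_baseSet_trivializationAt' x)
      (FiberBundle.mem_baseSet_trivializationAt' x)]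
    exact ContinuousLinearMap.isInvertible_equiv.comp
      ((hinv x).comp ContinuousLinearMap.isInvertible_equiv)
  refine (h2.contMDiffAt.comp x h1).congr_of_eventuallyEq ?_
  have A : (trivializationAt E (TangentSpace 𝓘(ℝ, E)) x).baseSet ∈ 𝓝 x :=
    (trivializationAt _ _ _).open_baseSet.mem_nhds (FiberBundle.mem_baseSet_trivializationAt' _)
  have B : (trivializationAt (E →L[ℝ] ℝ)
      (fun y : M => TangentSpace 𝓘(ℝ, E) y →L[ℝ] ℝ) x).baseSet ∈ 𝓝 x :=
    (trivializationAt _ _ _).open_baseSet.mem_nhds (FiberBundle.mem_baseSet_trivializationAt' _)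
  filter_upwards [A, B] with y hy hy'
  simp only [Function.comp_apply]
  rw [ContinuousLinearMap.inCoordinates_eq (by exact hy') (by exact hy),
    ContinuousLinearMap.inCoordinates_eq hy hy']
  simp only [ContinuousLinearMap.inverse_equiv_comp, ContinuousLinearMap.inverse_comp_equiv,
    ContinuousLinearEquiv.symm_symm]
  rfl

end Sharp

/-! ### Fundamental vector fields of smooth actions. -/

section Actions

variable {F : Type*} [NormedAddCommGroup F] [NormedSpace ℝ F]
  {G : Type*} [TopologicalSpace G] [ChartedSpace F G] [Group G] [LieGroup 𝓘(ℝ, F) ∞ G]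
  {E : Type*} [NormedAddCommGroup E] [NormedSpace ℝ E]
  {M : Type*} [TopologicalSpace M] [ChartedSpace E M] [IsManifold 𝓘(ℝ, E) ∞ M]

/-- All fibres have the same underlying type `E`; this moves a vector between base points, such as
`A.act 1 y` and `y`, that are equal only by a proof. -/
lemma tangentBundle_mk_congr {x y : M} (h : x = y) (v : E) :
    (⟨x, v⟩ : TangentBundle 𝓘(ℝ, E) M) = ⟨y, v⟩ := by
  subst h; rfl

lemma SmoothAction.contMDiff_act (A : SmoothAction F G E M) (a : G) :
    ContMDiff 𝓘(ℝ, E) 𝓘(ℝ, E) ∞ (A.act a) :=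
  A.smooth.comp (contMDiff_const.prodMk contMDiff_id)

lemma SmoothAction.contMDiff_orbit (A : SmoothAction F G E M) (x : M) :
    ContMDiff 𝓘(ℝ, F) 𝓘(ℝ, E) ∞ (fun a => A.act a x) :=
  A.smooth.comp (contMDiff_id.prodMk contMDiff_const)

lemma SmoothAction.continuous (A : SmoothAction F G E M) :
    Continuous (fun q : G × M => A.act q.1 q.2) :=
  A.smooth.continuous

/-- The derivative of a function along a fundamental vector field. -/
lemma SmoothAction.mvfderiv_fundamental (A : SmoothAction F G E M) {u : M → ℝ} {x : M}
    (hu : MDifferentiableAt 𝓘(ℝ, E) 𝓘(ℝ, ℝ) u x) (X : GroupLieAlgebra 𝓘(ℝ, F) G) :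
    mvfderiv 𝓘(ℝ, F) (fun a => u (A.act a x)) 1 X
      = mvfderiv 𝓘(ℝ, E) u x (A.fundamental x X) := by
  have h1 : MDifferentiableAt 𝓘(ℝ, F) 𝓘(ℝ, E) (fun a : G => A.act a x) 1 :=
    (A.contMDiff_orbit x).mdifferentiableAt (by simp)
  have h2 : HasMFDerivAt 𝓘(ℝ, E) 𝓘(ℝ, ℝ) u (A.act 1 x)
      (mfderiv 𝓘(ℝ, E) 𝓘(ℝ, ℝ) u (A.act 1 x)) := by
    rw [A.one_act]; exact hu.hasMFDerivAt
  have h3 := (h2.comp (1 : G) h1.hasMFDerivAt).mfderiv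
  have h4 : ∀ y, y = x → ∀ v : E, (mvfderiv 𝓘(ℝ, E) u y (v : TangentSpace 𝓘(ℝ, E) y))
      = mvfderiv 𝓘(ℝ, E) u x (v : TangentSpace 𝓘(ℝ, E) x) := by
    rintro y rfl v; rfl
  calc mvfderiv 𝓘(ℝ, F) (fun a => u (A.act a x)) 1 X
      = mvfderiv 𝓘(ℝ, E) u (A.act 1 x) (mfderiv 𝓘(ℝ, F) 𝓘(ℝ, E) (fun a : G => A.act a x) 1 X) := by
        unfold mvfderiv
        erw [h3]
        rfl
    _ = _ := h4 _ (A.one_act x) _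

lemma SmoothAction.fundamental_smoothAt (A : SmoothAction F G E M)
    (X : GroupLieAlgebra 𝓘(ℝ, F) G) (x : M) :
    VField.SmoothAt (fun y => A.fundamental y X) x := by
  have h1 := ContMDiffAt.mfderiv (I := 𝓘(ℝ, F)) (I' := 𝓘(ℝ, E)) (J := 𝓘(ℝ, E)) (n := ∞) (m := ∞)
    (x₀ := x) (fun (y : M) (a : G) => A.act a y) (fun _ => (1 : G))
    (ContMDiff.contMDiffAt (A.smooth.comp (contMDiff_snd.prodMk contMDiff_fst)))
    contMDiffAt_const (by simp)
  have h2 : ContMDiffAt 𝓘(ℝ, E) (𝓘(ℝ, F).prod 𝓘(ℝ, F)) ∞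
      (fun _ : M => (⟨1, X⟩ : TangentBundle 𝓘(ℝ, F) G)) x := contMDiffAt_const
  have h3 := ContMDiffAt.clm_apply_of_inCoordinates (F₁ := F) (F₂ := E)
    (E₁ := TangentSpace 𝓘(ℝ, F) (M := G)) (E₂ := TangentSpace 𝓘(ℝ, E) (M := M))
    (b₁ := fun _ : M => (1 : G)) (b₂ := fun y => A.act 1 y) (v := fun _ => X) h1 h2
    (A.contMDiff_act 1 x)
  refine h3.congr_of_eventuallyEq (Filter.Eventually.of_forall fun y => ?_)
  exact tangentBundle_mk_congr (A.one_act y).symm _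

/-- A vector field that is invariant under a smooth action commutes with the fundamental vector
fields. -/
lemma SmoothAction.mlieBracket_fundamental_eq_zero [CompleteSpace E]
    (A : SmoothAction F G E M)
    {Y : VField E M} {x : M} (hY : Y.DiffAt x)
    (hinv : ∀ a y, mfderiv 𝓘(ℝ, E) 𝓘(ℝ, E) (A.act a) y (Y y) = Y (A.act a y))
    (X : GroupLieAlgebra 𝓘(ℝ, F) G) :
    VectorField.mlieBracket 𝓘(ℝ, E) (fun y => A.fundamental y X) Y x = 0 := by
  have : IsManifold 𝓘(ℝ, E) 2 M := inferInstance
  have : IsManifold 𝓘(ℝ, E) 1 M := inferInstance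
  have : IsManifold 𝓘(ℝ, F) ∞ G := inferInstance
  have : IsManifold 𝓘(ℝ, F) 2 G := inferInstance
  refine eq_zero_of_forall_mvfderiv_eq_zero fun u hu => ?_
  have hev : ∀ᶠ y in 𝓝 x, MDifferentiableAt 𝓘(ℝ, E) 𝓘(ℝ, ℝ) u y := by
    have hu1 : ContMDiffAt 𝓘(ℝ, E) 𝓘(ℝ, ℝ) 1 u x := hu.of_le ENat.LEInfty.out
    filter_upwards [(contMDiffAt_iff_contMDiffAt_nhds (by simp)).1 hu1] with y hy
    exact hy.mdifferentiableAt (by norm_num)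
  rw [mvfderiv_mlieBracket (hu.of_le ENat.LEInfty.out) (A.fundamental_smoothAt X x).diffAt hY,
    sub_eq_zero]
  -- Take both derivatives of (a, y) ↦ u(a · y). By invariance of `Y`, its `Y`-derivative at `x` is
  -- (Yu)(a · x); its derivative at a = 1 is X̄u. Symmetry of mixed derivatives gives X̄(Yu) =
  -- Y(X̄u).
  have hw : ContMDiffAt (𝓘(ℝ, F).prod 𝓘(ℝ, E)) 𝓘(ℝ, ℝ) 2
      (fun q : G × M => u (A.act q.1 q.2)) (1, x) := by
    refine ContMDiffAt.comp (1, x) (g := u) ?_ (A.smooth.contMDiffAt.of_le ENat.LEInfty.out)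
    simpa [A.one_act] using hu.of_le ENat.LEInfty.out
  have h1 := mvfderiv_mvfderiv_comm hw X (Y x)
  have horb : Filter.Tendsto (fun a => A.act a x) (𝓝 (1 : G)) (𝓝 x) := by
    have := (A.contMDiff_orbit x).continuous.tendsto 1
    rwa [A.one_act] at this
  have h2 : (fun b => mvfderiv 𝓘(ℝ, E) (fun y => u (A.act b y)) x (Y x))
      =ᶠ[𝓝 (1 : G)] fun b => mvfderiv 𝓘(ℝ, E) u (A.act b x) (Y (A.act b x)) := by
    filter_upwards [horb.eventually hev] with b hb
    rw [← hinv b x]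
    exact mvfderiv_comp_apply x hb ((A.contMDiff_act b).mdifferentiableAt (by simp)) _
  have h3 : (fun y => mvfderiv 𝓘(ℝ, F) (fun b => u (A.act b y)) 1 X)
      =ᶠ[𝓝 x] fun y => mvfderiv 𝓘(ℝ, E) u y (A.fundamental y X) := by
    filter_upwards [hev] with y hy
    exact A.mvfderiv_fundamental hy X
  have h4 : MDifferentiableAt 𝓘(ℝ, E) 𝓘(ℝ, ℝ) (fun y => mvfderiv 𝓘(ℝ, E) u y (Y y)) x :=
    (OneForm.smoothAt_of_eventually_mvfderiv (θ := fun y => mvfderiv 𝓘(ℝ, E) u y) hu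
      (Filter.Eventually.of_forall fun _ => rfl)).mdifferentiableAt hY
  rw [← A.mvfderiv_fundamental h4 X]
  calc _ = mvfderiv 𝓘(ℝ, F)
        (fun b => mvfderiv 𝓘(ℝ, E) (fun y => u (A.act b y)) x (Y x)) 1 X := by
        unfold mvfderiv at h2 ⊢
        rw [← h2.mfderiv_eq]
        simp
        rfl
    _ = _ := h1
    _ = _ := by
        unfold mvfderiv at h3 ⊢
        rw [h3.mfderiv_eq]
        simp
        rfl

end Actions


/-! ### Linear algebra of the fundamental form. -/

section LinearAlgebra

variable {V : Type*} [NormedAddCommGroup V] [InnerProductSpace ℝ V] [FiniteDimensional ℝ V]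

/-- The Lefschetz map `α ↦ α ∧ ω` is injective on covectors in real dimension greater than two. -/
lemma eq_zero_of_wedge_fundamentalForm_eq_zero (hdim : 2 < Module.finrank ℝ V) {j : V → V}
    (hherm : ∀ u v, inner ℝ (j u) (j v) = inner ℝ u v) {α : V → ℝ}
    (h : ∀ u v w, α u * inner ℝ (j v) w - α v * inner ℝ (j u) w + α w * inner ℝ (j u) v = 0)
    (v : V) : α v = 0 := by
  -- As the dimension exceeds two, some u ≠ 0 is orthogonal to `v` and `j v`; on the triple (v, u, j
  -- u) the relation collapses to α(v)‖u‖² = 0.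
  set W : Submodule ℝ V := Submodule.span ℝ {v, j v}
  have hW : Module.finrank ℝ W ≤ 2 := by
    classical
    have := finrank_span_finset_le_card (R := ℝ) ({v, j v} : Finset V)
    simp only [Finset.coe_insert, Finset.coe_singleton] at this
    exact this.trans Finset.card_le_two
  have hsum := W.finrank_add_finrank_orthogonal
  have hpos : 0 < Module.finrank ℝ Wᗮ := by omega
  obtain ⟨⟨u, hu⟩, hu0⟩ := Module.finrank_pos_iff_exists_ne_zero.1 hpos
  have hu0' : u ≠ 0 := fun h => hu0 (Subtype.ext h)
  have h1 : inner ℝ v u = 0 := hu v (Submodule.subset_span (by simp))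
  have h2 : inner ℝ (j v) u = 0 := hu (j v) (Submodule.subset_span (by simp))
  have h3 := h v u (j u)
  rw [hherm, hherm, h1, h2, mul_zero, mul_zero, sub_zero, add_zero] at h3
  exact (mul_eq_zero.1 h3).resolve_right (inner_self_ne_zero.2 hu0')

end LinearAlgebra

/-! ### The structure equation of an lcK manifold. -/

section LCK

variable {E : Type*} [NormedAddCommGroup E] [NormedSpace ℝ E]
  {M : Type*} [TopologicalSpace M] [ChartedSpace E M] [IsManifold 𝓘(ℝ, E) ∞ M]
  [Bundle.RiemannianBundle (fun x : M => TangentSpace 𝓘(ℝ, E) x)]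
  [IsContMDiffRiemannianBundle 𝓘(ℝ, E) ∞ E (fun x : M => TangentSpace 𝓘(ℝ, E) x)]
  {J : EndField E M} {θ : OneForm E M}

lemma IsLCK.exists_primitive (hM : IsLCK J θ) (x : M) : ∃ U : Set M, IsOpen U ∧ x ∈ U ∧
    ∃ f : M → ℝ, (∀ y ∈ U, ContMDiffAt 𝓘(ℝ, E) 𝓘(ℝ, ℝ) ∞ f y) ∧
      ∀ y ∈ U, mvfderiv 𝓘(ℝ, E) f y = θ y := by
  obtain ⟨U, hU, hx, f, hf, hfθ, -⟩ := hM.locallyConformal x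
  exact ⟨U, hU, hx, f, fun y hy => hf.contMDiffAt (hU.mem_nhds hy), hfθ⟩

lemma IsLCK.smoothAt (hM : IsLCK J θ) (x : M) : θ.SmoothAt x := by
  obtain ⟨U, hU, hx, f, hf, hfθ⟩ := hM.exists_primitive x
  exact OneForm.smoothAt_of_eventually_mvfderiv (hf x hx)
    (Filter.eventually_of_mem (hU.mem_nhds hx) hfθ)

lemma fundamentalForm_mdifferentiableAt (hJ : J.IsSmooth) {x : M} {Y Z : VField E M}
    (hY : Y.DiffAt x) (hZ : Z.DiffAt x) :
    MDifferentiableAt 𝓘(ℝ, E) 𝓘(ℝ, ℝ) (fun y => fundamentalForm J y (Y y) (Z y)) x :=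
  (hJ.diffAt hY).inner hZ

/-- The structure equation `dω = θ ∧ ω`. -/
lemma IsLCK.extDeriv_fundamentalForm (hM : IsLCK J θ) {x : M} {X Y Z : VField E M}
    (hX : X.DiffAt x) (hY : Y.DiffAt x) (hZ : Z.DiffAt x) :
    extDerivTwoForm (fundamentalForm J) X Y Z x
      = θ x (X x) * fundamentalForm J x (Y x) (Z x) - θ x (Y x) * fundamentalForm J x (X x) (Z x)
        + θ x (Z x) * fundamentalForm J x (X x) (Y x) := by
  obtain ⟨U, hU, hx, f, hf, hfθ, hcl⟩ := hM.locallyConformal x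
  have h0 := hcl x hx X Y Z hX hY hZ
  have hfx : MDifferentiableAt 𝓘(ℝ, E) 𝓘(ℝ, ℝ) f x :=
    (hf.contMDiffAt (hU.mem_nhds hx)).mdifferentiableAt (by simp)
  have hexp : HasDerivAt (fun t : ℝ => Real.exp (-t)) (-Real.exp (-f x)) (f x) := by
    simpa using (hasDerivAt_neg (f x)).exp
  -- The product rule, applied to every coefficient, amounts to d(e^{-f}ω) = e^{-f}(dω - θ ∧ ω).
  have hprod : ∀ w : M → ℝ, MDifferentiableAt 𝓘(ℝ, E) 𝓘(ℝ, ℝ) w x → ∀ v,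
      mvfderiv 𝓘(ℝ, E) (fun y => Real.exp (-f y) * w y) x v
        = Real.exp (-f x) * (mvfderiv 𝓘(ℝ, E) w x v - θ x v * w x) := by
    intro w hw v
    rw [mvfderiv_fun_mul (mvfderiv_real_comp hexp hfx v).1 hw]
    have : mvfderiv 𝓘(ℝ, E) (fun y => Real.exp (-f y)) x v = -Real.exp (-f x) * θ x v := by
      rw [(mvfderiv_real_comp hexp hfx v).2, hfθ x hx]
    simp [this]
    ring
  unfold extDerivTwoForm at h0 ⊢
  have hJ := hM.complex.smooth
  rw [hprod _ (fundamentalForm_mdifferentiableAt hJ hY hZ),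
    hprod _ (fundamentalForm_mdifferentiableAt hJ hX hZ),
    hprod _ (fundamentalForm_mdifferentiableAt hJ hX hY)] at h0
  have h1 := Real.exp_pos (-f x)
  rw [← mul_right_inj' h1.ne', ← sub_eq_zero, ← h0]
  ring

end LCK

/-! ### Invariance of the Lee form under holomorphic isometries. -/

section Invariance

variable {F : Type*} [NormedAddCommGroup F] [NormedSpace ℝ F]
  {G : Type*} [TopologicalSpace G] [ChartedSpace F G] [Group G] [LieGroup 𝓘(ℝ, F) ∞ G]
  {E : Type*} [NormedAddCommGroup E] [NormedSpace ℝ E]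
  {M : Type*} [TopologicalSpace M] [ChartedSpace E M] [IsManifold 𝓘(ℝ, E) ∞ M]

lemma SmoothAction.inv_act_act (A : SmoothAction F G E M) (a : G) (x : M) :
    A.act a⁻¹ (A.act a x) = x := by
  rw [← A.mul_act, inv_mul_cancel, A.one_act]

lemma SmoothAction.isInvertible_mfderiv (A : SmoothAction F G E M) (a : G) (x : M) :
    (mfderiv 𝓘(ℝ, E) 𝓘(ℝ, E) (A.act a) x).IsInvertible := by
  have key : ∀ b c : G, b * c = 1 → ∀ (y : M) (v : E),
      mfderiv 𝓘(ℝ, E) 𝓘(ℝ, E) (A.act b) (A.act c y) (mfderiv 𝓘(ℝ, E) 𝓘(ℝ, E) (A.act c) y v) = v := by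
    intro b c hbc y v
    have h1 := mfderiv_comp_apply (I := 𝓘(ℝ, E)) (I' := 𝓘(ℝ, E)) (I'' := 𝓘(ℝ, E)) y
      ((A.contMDiff_act b).mdifferentiableAt (x := A.act c y) (by simp))
      ((A.contMDiff_act c).mdifferentiableAt (by simp)) v
    have h2 : A.act b ∘ A.act c = id := by
      ext z; simp [← A.mul_act, hbc, A.one_act]
    rw [← h1, h2, mfderiv_id]
    rfl
  have h := A.inv_act_act a x
  refine ⟨ContinuousLinearEquiv.equivOfInverse (mfderiv 𝓘(ℝ, E) 𝓘(ℝ, E) (A.act a) x)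
    (mfderiv 𝓘(ℝ, E) 𝓘(ℝ, E) (A.act a⁻¹) (A.act a x)) (fun v => key _ _ (by simp) x v) ?_, rfl⟩
  intro v
  have := key a a⁻¹ (by simp) (A.act a x) v
  rw [h] at this
  exact this

variable [FiniteDimensional ℝ E]
  [Bundle.RiemannianBundle (fun x : M => TangentSpace 𝓘(ℝ, E) x)]
  [IsContMDiffRiemannianBundle 𝓘(ℝ, E) ∞ E (fun x : M => TangentSpace 𝓘(ℝ, E) x)]
  {J : EndField E M} {θ : OneForm E M}

/-- Holomorphic isometries preserve the Lee form. -/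
lemma SmoothAction.ByVaismanAutomorphisms.lee_invariant {A : SmoothAction F G E M}
    (hA : A.ByVaismanAutomorphisms J) (hM : IsLCK J θ) (a : G) (x : M)
    (v : TangentSpace 𝓘(ℝ, E) x) :
    θ (A.act a x) (mfderiv 𝓘(ℝ, E) 𝓘(ℝ, E) (A.act a) x v) = θ x v := by
  have : IsManifold 𝓘(ℝ, E) 2 M := inferInstance
  have : IsManifold 𝓘(ℝ, E) (minSmoothness ℝ 2) M := by
    rw [minSmoothness_of_isRCLikeNormedField]; infer_instance
  have : IsManifold 𝓘(ℝ, E) (minSmoothness ℝ 3) M := by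
    rw [minSmoothness_of_isRCLikeNormedField]; infer_instance
  have hact : ∀ y, MDifferentiableAt 𝓘(ℝ, E) 𝓘(ℝ, E) (A.act a) y := fun y =>
    (A.contMDiff_act a).mdifferentiableAt (by simp)
  -- The exterior derivative is evaluated on vector fields, so fields near `A.act a x` are pulled
  -- back to `x`; values, brackets and derivatives are then compared one by one.
  have hpush : ∀ (X : VField E M) (y : M), mfderiv 𝓘(ℝ, E) 𝓘(ℝ, E) (A.act a) y
      (VectorField.mpullback 𝓘(ℝ, E) 𝓘(ℝ, E) (A.act a) X y) = X (A.act a y) := by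
    intro X y
    rw [VectorField.mpullback_apply]
    obtain ⟨e, he⟩ := A.isInvertible_mfderiv a y
    rw [← he, ContinuousLinearMap.inverse_equiv]
    exact e.apply_symm_apply _
  have hform : ∀ (y : M) (u w : TangentSpace 𝓘(ℝ, E) y),
      fundamentalForm J (A.act a y) (mfderiv 𝓘(ℝ, E) 𝓘(ℝ, E) (A.act a) y u)
        (mfderiv 𝓘(ℝ, E) 𝓘(ℝ, E) (A.act a) y w) = fundamentalForm J y u w := by
    intro y u w
    unfold fundamentalForm
    rw [← hA.holomorphic, hA.isometric]
  have hdiff : ∀ X : VField E M, X.SmoothAt (A.act a x) →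
      VField.DiffAt (VectorField.mpullback 𝓘(ℝ, E) 𝓘(ℝ, E) (A.act a) X) x := by
    intro X hX
    exact MDifferentiableAt.mpullback_vectorField hX.diffAt
      ((A.contMDiff_act a).contMDiffAt) (A.isInvertible_mfderiv a x) ENat.LEInfty.out
  have hbr : ∀ X Y : VField E M, X.SmoothAt (A.act a x) → Y.SmoothAt (A.act a x) →
      mfderiv 𝓘(ℝ, E) 𝓘(ℝ, E) (A.act a) x (VectorField.mlieBracket 𝓘(ℝ, E)
        (VectorField.mpullback 𝓘(ℝ, E) 𝓘(ℝ, E) (A.act a) X)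
        (VectorField.mpullback 𝓘(ℝ, E) 𝓘(ℝ, E) (A.act a) Y) x)
      = VectorField.mlieBracket 𝓘(ℝ, E) X Y (A.act a x) := by
    intro X Y hX hY
    rw [← VectorField.mpullback_mlieBracket hX.diffAt hY.diffAt
      ((A.contMDiff_act a).contMDiffAt) (by simp; exact ENat.LEInfty.out), hpush]
  have hd : ∀ X Y Z : VField E M, X.SmoothAt (A.act a x) → Y.SmoothAt (A.act a x) →
      mvfderiv 𝓘(ℝ, E) (fun y => fundamentalForm J y
        (VectorField.mpullback 𝓘(ℝ, E) 𝓘(ℝ, E) (A.act a) X y)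
        (VectorField.mpullback 𝓘(ℝ, E) 𝓘(ℝ, E) (A.act a) Y y)) x
        (VectorField.mpullback 𝓘(ℝ, E) 𝓘(ℝ, E) (A.act a) Z x)
      = mvfderiv 𝓘(ℝ, E) (fun y => fundamentalForm J y (X y) (Y y)) (A.act a x)
        (Z (A.act a x)) := by
    intro X Y Z hX hY
    have h1 : (fun y => fundamentalForm J y
        (VectorField.mpullback 𝓘(ℝ, E) 𝓘(ℝ, E) (A.act a) X y)
        (VectorField.mpullback 𝓘(ℝ, E) 𝓘(ℝ, E) (A.act a) Y y))
        = (fun y => fundamentalForm J y (X y) (Y y)) ∘ A.act a := by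
      ext y
      rw [← hform, hpush, hpush]
      rfl
    rw [h1, mvfderiv_comp_apply x (fundamentalForm_mdifferentiableAt hM.complex.smooth hX.diffAt
      hY.diffAt) (hact x), hpush]
  -- The action preserves ω, hence also dω = θ ∧ ω; subtracting the structure equations at the two
  -- points gives (a^*θ - θ) ∧ ω = 0, where the Lefschetz map is injective.
  have hwedge : ∀ u v w : TangentSpace 𝓘(ℝ, E) x,
      (θ (A.act a x) (mfderiv 𝓘(ℝ, E) 𝓘(ℝ, E) (A.act a) x u) - θ x u) * inner ℝ (J x v) w
      - (θ (A.act a x) (mfderiv 𝓘(ℝ, E) 𝓘(ℝ, E) (A.act a) x v) - θ x v) * inner ℝ (J x u) w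
      + (θ (A.act a x) (mfderiv 𝓘(ℝ, E) 𝓘(ℝ, E) (A.act a) x w) - θ x w) * inner ℝ (J x u) v
      = 0 := by
    intro u v w
    obtain ⟨X, hX, hXu⟩ := exists_smoothAt_eq _ (mfderiv 𝓘(ℝ, E) 𝓘(ℝ, E) (A.act a) x u)
    obtain ⟨Y, hY, hYv⟩ := exists_smoothAt_eq _ (mfderiv 𝓘(ℝ, E) 𝓘(ℝ, E) (A.act a) x v)
    obtain ⟨Z, hZ, hZw⟩ := exists_smoothAt_eq _ (mfderiv 𝓘(ℝ, E) 𝓘(ℝ, E) (A.act a) x w)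
    have hinj : Function.Injective (mfderiv 𝓘(ℝ, E) 𝓘(ℝ, E) (A.act a) x) := by
      obtain ⟨e, he⟩ := A.isInvertible_mfderiv a x
      rw [← he]
      exact e.injective
    have e1 := hM.extDeriv_fundamentalForm hX.diffAt hY.diffAt hZ.diffAt
    have e2 := hM.extDeriv_fundamentalForm (hdiff X hX) (hdiff Y hY) (hdiff Z hZ)
    unfold extDerivTwoForm at e1 e2
    rw [hd Y Z X hY hZ, hd X Z Y hX hZ, hd X Y Z hX hY] at e2
    rw [← hform x (VectorField.mlieBracket _ _ _ _), hbr X Y hX hY, hpush Z,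
      ← hform x (VectorField.mlieBracket _ _ _ _), hbr X Z hX hZ, hpush Y,
      ← hform x (VectorField.mlieBracket _ _ _ _), hbr Y Z hY hZ, hpush X, e1] at e2
    have gX := hinj ((hpush X x).trans hXu)
    have gY := hinj ((hpush Y x).trans hYv)
    have gZ := hinj ((hpush Z x).trans hZw)
    rw [gX, gY, gZ, hXu, hYv, hZw, hform, hform, hform] at e2
    unfold fundamentalForm at e2
    linarith
  have := eq_zero_of_wedge_fundamentalForm_eq_zero (V := TangentSpace 𝓘(ℝ, E) x) hM.two_lt_dim
    (hM.hermitian x) hwedge v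
  linarith

end Invariance


section Calculus

variable {E : Type*} [NormedAddCommGroup E] [NormedSpace ℝ E]
  {M : Type*} [TopologicalSpace M] [ChartedSpace E M]

lemma mvfderiv_congr {f g : M → ℝ} {x : M} (h : f =ᶠ[𝓝 x] g) (v : TangentSpace 𝓘(ℝ, E) x) :
    mvfderiv 𝓘(ℝ, E) f x v = mvfderiv 𝓘(ℝ, E) g x v :=
  DFunLike.congr_fun h.mfderiv_eq v

lemma mvfderiv_eq_zero_of_isLocalMax {f : M → ℝ} {x : M}
    (hf : MDifferentiableAt 𝓘(ℝ, E) 𝓘(ℝ, ℝ) f x) (h : IsLocalMax f x)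
    (v : TangentSpace 𝓘(ℝ, E) x) : mvfderiv 𝓘(ℝ, E) f x v = 0 := by
  rw [mvfderiv_eq_fderiv_chart hf]
  have hmax : IsLocalMax (f ∘ (extChartAt 𝓘(ℝ, E) x).symm) (extChartAt 𝓘(ℝ, E) x x) := by
    have hc : Filter.Tendsto (extChartAt 𝓘(ℝ, E) x).symm (𝓝 (extChartAt 𝓘(ℝ, E) x x)) (𝓝 x) := by
      simpa [ContinuousAt] using continuousAt_extChartAt_symm (I := 𝓘(ℝ, E)) x
    filter_upwards [hc.eventually h] with z hz
    simpa using hz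
  rw [hmax.fderiv_eq_zero]
  rfl

end Calculus

/-! ### Vanishing of the Lee form on fundamental fields. -/

section LeeForm

variable {F : Type*} [NormedAddCommGroup F] [NormedSpace ℝ F]
  {G : Type*} [TopologicalSpace G] [ChartedSpace F G] [Group G] [LieGroup 𝓘(ℝ, F) ∞ G]
  {E : Type*} [NormedAddCommGroup E] [NormedSpace ℝ E] [FiniteDimensional ℝ E]
  {M : Type*} [TopologicalSpace M] [ChartedSpace E M] [IsManifold 𝓘(ℝ, E) ∞ M]
  [Bundle.RiemannianBundle (fun x : M => TangentSpace 𝓘(ℝ, E) x)]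
  [IsContMDiffRiemannianBundle 𝓘(ℝ, E) ∞ E (fun x : M => TangentSpace 𝓘(ℝ, E) x)]
  {J : EndField E M} {θ : OneForm E M} {A : SmoothAction F G E M}

lemma IsLCK.fundamentalForm_self (hM : IsLCK J θ) (x : M) (v : TangentSpace 𝓘(ℝ, E) x) :
    fundamentalForm J x v v = 0 := by
  have h1 := hM.hermitian x v (J x v)
  rw [hM.complex.sq_eq_neg, inner_neg_right] at h1
  unfold fundamentalForm
  linarith [real_inner_comm v (J x v)]

/-- For a holomorphic isometric action, the Lee form takes locally constant values on
fundamental vector fields. -/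
lemma SmoothAction.ByVaismanAutomorphisms.isLocallyConstant_lee_fundamental
    (hA : A.ByVaismanAutomorphisms J) (hM : IsLCK J θ) (X : GroupLieAlgebra 𝓘(ℝ, F) G) :
    IsLocallyConstant (fun x => θ x (A.fundamental x X)) := by
  have : IsManifold 𝓘(ℝ, E) 1 M := inferInstance
  rw [IsLocallyConstant.iff_eventually_eq]
  intro x
  obtain ⟨U, hU, hx, f, hf, hfθ⟩ := hM.exists_primitive x
  have hmem : (fun q : G × M => A.act q.1 q.2) ⁻¹' U ∈ 𝓝 ((1 : G), x) :=
    A.continuous.continuousAt.preimage_mem_nhds (by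
      simpa [A.one_act] using hU.mem_nhds hx)
  rw [nhds_prod_eq, Filter.mem_prod_iff] at hmem
  obtain ⟨V, hV, W₀, hW₀, hVW⟩ := hmem
  obtain ⟨W, hWsub, hWo, hxW, hW⟩ := exists_nhds_eqOn_of_mvfderiv_eq_zero (E := E) ℝ
    (Filter.inter_mem hW₀ (hU.mem_nhds hx))
  have hd : ∀ y ∈ U, MDifferentiableAt 𝓘(ℝ, E) 𝓘(ℝ, ℝ) f y := fun y hy =>
    (hf y hy).mdifferentiableAt (by simp)
  -- Invariance of θ kills the derivative of f ∘ b - f. Thus b ↦ f(b · y) and b ↦ f(b · x) differ by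
  -- a constant, and their derivatives at b = 1, which are the values of θ on the fundamental field,
  -- agree.
  have hconst : ∀ b ∈ V, ∀ y ∈ W, f (A.act b y) - f y = f (A.act b x) - f x := by
    intro b hb
    refine hW (fun y => f (A.act b y) - f y) fun y hy => ?_
    have hy1 : A.act b y ∈ U := hVW (Set.mk_mem_prod hb (hWsub hy).1)
    have hy2 : y ∈ U := (hWsub hy).2
    have hact : MDifferentiableAt 𝓘(ℝ, E) 𝓘(ℝ, E) (A.act b) y :=
      (A.contMDiff_act b).mdifferentiableAt (by simp)
    have h1 : MDifferentiableAt 𝓘(ℝ, E) 𝓘(ℝ, ℝ) (fun y => f (A.act b y)) y :=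
      (hd _ hy1).comp y hact
    refine ⟨h1.sub (hd _ hy2), fun v => ?_⟩
    rw [mvfderiv_fun_sub h1 (hd _ hy2)]
    have h2 := mvfderiv_comp_apply (I := 𝓘(ℝ, E)) y (hd _ hy1) hact v
    rw [hfθ _ hy1, hA.lee_invariant hM] at h2
    change mvfderiv 𝓘(ℝ, E) (f ∘ A.act b) y v - mvfderiv 𝓘(ℝ, E) f y v = 0
    rw [h2, hfθ _ hy2, sub_self]
  have hval : ∀ y ∈ W, θ y (A.fundamental y X)
      = mvfderiv 𝓘(ℝ, F) (fun b => f (A.act b y)) 1 X := fun y hy => by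
    rw [A.mvfderiv_fundamental (hd y (hWsub hy).2) X, hfθ y (hWsub hy).2]
  filter_upwards [hWo.mem_nhds hxW] with y hy
  rw [hval y hy, hval x hxW]
  have h1 : (fun b => f (A.act b y)) =ᶠ[𝓝 (1 : G)] fun b => f (A.act b x) + (f y - f x) := by
    filter_upwards [hV] with b hb
    linarith [hconst b hb y hy]
  have h2 : MDifferentiableAt 𝓘(ℝ, F) 𝓘(ℝ, ℝ) (fun b => f (A.act b x)) 1 := by
    refine MDifferentiableAt.comp (I' := 𝓘(ℝ, E)) (1 : G) (g := f) ?_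
      ((A.contMDiff_orbit x).mdifferentiableAt (by simp))
    rw [A.one_act]
    exact hd x hx
  rw [mvfderiv_congr h1, mvfderiv_fun_add h2 mdifferentiableAt_const, mvfderiv_const, add_zero]

/-- For a twisted Hamiltonian action of a compact group, the Lee form vanishes on the fundamental
vector fields. -/
lemma IsTwistedMomentMap.lee_fundamental_eq_zero [CompactSpace G] [PreconnectedSpace M]
    {μ : M → LieDual F G} (hμ : IsTwistedMomentMap J θ A μ)
    (hA : A.ByVaismanAutomorphisms J) (hM : IsLCK J θ) (X : GroupLieAlgebra 𝓘(ℝ, F) G) (x : M) :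
    θ x (A.fundamental x X) = 0 := by
  by_contra hne
  have hconst : ∀ y, θ y (A.fundamental y X) = θ x (A.fundamental x X) := fun y =>
    (hA.isLocallyConstant_lee_fundamental hM X).apply_eq_of_isPreconnected isPreconnected_univ
      (Set.mem_univ _) (Set.mem_univ _)
  have hsmooth : ∀ y, MDifferentiableAt 𝓘(ℝ, E) 𝓘(ℝ, ℝ) (fun z => μ z X) y := fun y =>
    (hμ.smooth X).mdifferentiableAt (by simp)
  -- On X̄ itself the right-hand side ω(X̄, X̄) vanishes, leaving μ^X θ(X̄) = 0.
  have hcrit : ∀ y, mvfderiv 𝓘(ℝ, E) (fun z => μ z X) y (A.fundamental y X) = 0 → μ y X = 0 := by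
    intro y hy
    have h1 := hμ.eq X y (A.fundamental y X)
    rw [hy, hM.fundamentalForm_self, hconst y, zero_sub, neg_eq_zero] at h1
    exact (mul_eq_zero.1 h1).resolve_right hne
  have hcont : ∀ y, Continuous (fun a => μ (A.act a y) X) := fun y =>
    (hμ.smooth X).continuous.comp (A.contMDiff_orbit y).continuous
  -- The values `ε = 1` and `ε = -1` treat the maximum and the minimum on an orbit together.
  have hmax : ∀ (ε : ℝ), ∀ y, ∃ a, μ (A.act a y) X * ε = 0 ∧
      ∀ b, μ (A.act b y) X * ε ≤ μ (A.act a y) X * ε := by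
    intro ε y
    obtain ⟨a, -, ha⟩ := isCompact_univ.exists_isMaxOn ⟨(1 : G), Set.mem_univ _⟩
      ((hcont y).mul continuous_const : Continuous fun a => μ (A.act a y) X * ε).continuousOn
    refine ⟨a, ?_, fun b => ha (Set.mem_univ b)⟩
    rcases eq_or_ne ε 0 with rfl | hε
    · simp
    rw [hcrit (A.act a y), zero_mul]
    -- The orbit is recentred at the maximum point, so that the critical point sits at the identity,
    -- where the fundamental field is defined.
    have h1 : IsLocalMax (fun b => μ (A.act b (A.act a y)) X * ε) 1 := by
      refine Filter.Eventually.of_forall fun b => ?_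
      simp only [← A.mul_act, one_mul]
      exact ha (Set.mem_univ (b * a))
    have h2 : MDifferentiableAt 𝓘(ℝ, F) 𝓘(ℝ, ℝ) (fun b => μ (A.act b (A.act a y)) X) 1 :=
      (hsmooth _).comp (1 : G) ((A.contMDiff_orbit _).mdifferentiableAt (by simp))
    have h3 := mvfderiv_eq_zero_of_isLocalMax (h2.mul mdifferentiableAt_const) h1 X
    rw [mvfderiv_mul h2 mdifferentiableAt_const, mvfderiv_const] at h3
    refine (A.mvfderiv_fundamental (hsmooth _) X).symm.trans ?_
    simpa [hε] using h3
  have hzero : (fun z => μ z X) = fun _ => (0 : ℝ) := by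
    ext y
    obtain ⟨a, ha, ha'⟩ := hmax 1 y
    obtain ⟨b, hb, hb'⟩ := hmax (-1) y
    have h1 := ha' 1
    have h2 := hb' 1
    rw [ha, A.one_act] at h1
    rw [hb, A.one_act] at h2
    linarith
  -- Since ω(X̄, J X̄) = ‖X̄‖², the equation with μ^X ≡ 0 forces X̄ = 0 at `x`.
  have h1 := hμ.eq X x (J x (A.fundamental x X))
  rw [hzero, mvfderiv_const] at h1
  have h2 : μ x X = 0 := congrFun hzero x
  unfold fundamentalForm at h1
  rw [h2, hM.hermitian] at h1
  rw [zero_mul, sub_zero, eq_comm] at h1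
  have h1 := inner_self_eq_zero.1 h1
  rw [h1, map_zero] at hne
  exact hne rfl

end LeeForm


/-! ### Lifting to the minimal covering. -/

section Sections

variable {E : Type*} [NormedAddCommGroup E] [NormedSpace ℝ E]
  {M : Type*} [TopologicalSpace M] [ChartedSpace E M]
  {N : Type*} [TopologicalSpace N] [ChartedSpace E N]

/-- A local diffeomorphism has smooth local sections. -/
lemma exists_local_section {p : N → M} (hp : IsLocalDiffeomorph 𝓘(ℝ, E) 𝓘(ℝ, E) ∞ p) (n : N) :
    ∃ W : Set M, ∃ U : Set N, ∃ s : M → N, IsOpen W ∧ IsOpen U ∧ n ∈ U ∧ p n ∈ W ∧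
      (∀ y ∈ W, ContMDiffAt 𝓘(ℝ, E) 𝓘(ℝ, E) ∞ s y) ∧ (∀ y ∈ W, p (s y) = y) ∧
      (∀ m ∈ U, p m ∈ W ∧ s (p m) = m) := by
  obtain ⟨Φ, hn, hΦ⟩ := hp n
  refine ⟨Φ.target, Φ.source, Φ.symm, Φ.open_target, Φ.open_source, hn, ?_, ?_, ?_, ?_⟩
  · rw [hΦ hn]; exact Φ.map_source hn
  · exact fun y hy => (Φ.contMDiffOn_invFun y hy).contMDiffAt (Φ.open_target.mem_nhds hy)
  · intro y hy
    have h1 : Φ.symm y ∈ Φ.source := Φ.map_target hy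
    rw [hΦ h1]
    exact Φ.right_inv hy
  · intro m hm
    rw [hΦ hm]
    exact ⟨Φ.map_source hm, Φ.left_inv hm⟩

variable {θ : OneForm E M} {p : N → M} {h : N → ℝ}

/-- The pullback of the primitive by a local section is a primitive of the Lee form. -/
lemma IsMinimalCovering.mvfderiv_comp_section (hp : IsMinimalCovering θ p h) {W : Set M} {s : M → N}
    (hW : IsOpen W) (hs : ∀ y ∈ W, ContMDiffAt 𝓘(ℝ, E) 𝓘(ℝ, E) ∞ s y) (hps : ∀ y ∈ W, p (s y) = y)
    {y : M} (hy : y ∈ W) :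
    MDifferentiableAt 𝓘(ℝ, E) 𝓘(ℝ, ℝ) (fun z => h (s z)) y ∧
    ∀ v, mvfderiv 𝓘(ℝ, E) (fun z => h (s z)) y v = θ y v := by
  have h1 : MDifferentiableAt 𝓘(ℝ, E) 𝓘(ℝ, E) s y := (hs y hy).mdifferentiableAt (by simp)
  have h2 : MDifferentiableAt 𝓘(ℝ, E) 𝓘(ℝ, ℝ) h (s y) :=
    hp.primitive_smooth.mdifferentiableAt (by simp)
  have h3 : MDifferentiableAt 𝓘(ℝ, E) 𝓘(ℝ, E) p (s y) :=
    (hp.localDiffeo.contMDiff.mdifferentiableAt (by simp))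
  refine ⟨h2.comp y h1, fun v => ?_⟩
  refine (mvfderiv_comp_apply y h2 h1 v).trans ?_
  rw [hp.primitive]
  have h4 : mfderiv 𝓘(ℝ, E) 𝓘(ℝ, E) (p ∘ s) y v = v := by
    have : p ∘ s =ᶠ[𝓝 y] id := by
      filter_upwards [hW.mem_nhds hy] with z hz using hps z hz
    rw [this.mfderiv_eq, mfderiv_id]
    rfl
  rw [mfderiv_comp_apply y h3 h1] at h4
  have h5 : ∀ z, z = y → ∀ w : E, θ z (w : TangentSpace 𝓘(ℝ, E) z)
      = θ y (w : TangentSpace 𝓘(ℝ, E) y) := by rintro z rfl w; rfl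
  exact (h5 _ (hps y hy) _).trans (congrArg (θ y) h4)

/-- Deck transformations change the primitive by a constant. -/
lemma IsMinimalCovering.deck_shift [IsManifold 𝓘(ℝ, E) 1 N]
    (hp : IsMinimalCovering θ p h) {φ : N ≃ₜ N}
    (hφ : IsDeckTransformation p φ) (x y : N) : h (φ x) - h x = h (φ y) - h y := by
  have := hp.connected
  have hloc : IsLocallyConstant (fun z => h (φ z) - h z) := by
    rw [IsLocallyConstant.iff_eventually_eq]
    intro z
    obtain ⟨W, U, s, hW, hU, hzU, hzW, hs, hps, hsp⟩ := exists_local_section hp.localDiffeo (φ z)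
    have hopen : φ ⁻¹' U ∈ 𝓝 z := φ.continuous.continuousAt.preimage_mem_nhds (hU.mem_nhds hzU)
    obtain ⟨V, hVsub, hVo, hzV, hV⟩ := exists_nhds_eqOn_of_mvfderiv_eq_zero (E := E) ℝ hopen
    filter_upwards [hVo.mem_nhds hzV] with y hy
    refine hV (fun z => h (φ z) - h z) (fun y hy => ?_) y hy
    have hpy : p y ∈ W := by rw [← hφ]; exact (hsp _ (hVsub hy)).1
    -- A deck transformation is only given as a homeomorphism. Locally it is `s ∘ p`, and `h ∘ s` is
    -- a primitive of θ, so `h ∘ φ` and `h` have the same differential.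
    have hev : (fun z => h (φ z) - h z) =ᶠ[𝓝 y] fun z => h (s (p z)) - h z := by
      filter_upwards [hVo.mem_nhds hy] with z hz
      rw [← hφ z, (hsp _ (hVsub hz)).2]
    obtain ⟨h1, h2⟩ := hp.mvfderiv_comp_section hW hs hps hpy
    have h3 : MDifferentiableAt 𝓘(ℝ, E) 𝓘(ℝ, E) p y :=
      (hp.localDiffeo.contMDiff.mdifferentiableAt (by simp))
    have h4 : MDifferentiableAt 𝓘(ℝ, E) 𝓘(ℝ, ℝ) (fun z => h (s (p z))) y := h1.comp y h3
    have h5 : MDifferentiableAt 𝓘(ℝ, E) 𝓘(ℝ, ℝ) h y :=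
      hp.primitive_smooth.mdifferentiableAt (by simp)
    refine ⟨(h4.sub h5).congr_of_eventuallyEq hev, fun v => ?_⟩
    rw [mvfderiv_congr hev, mvfderiv_fun_sub h4 h5]
    change mvfderiv 𝓘(ℝ, E) ((fun z => h (s z)) ∘ p) y v - mvfderiv 𝓘(ℝ, E) h y v = 0
    rw [mvfderiv_comp_apply y h1 h3, h2, hp.primitive, sub_self]
  exact hloc.apply_eq_of_isPreconnected isPreconnected_univ (Set.mem_univ _) (Set.mem_univ _)

/-- The covering projection and the primitive jointly separate points. -/
lemma IsMinimalCovering.eq_of_eq [IsManifold 𝓘(ℝ, E) 1 N]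
    (hp : IsMinimalCovering θ p h) {x y : N}
    (hpxy : p x = p y) (hh : h x = h y) : x = y := by
  obtain ⟨φ, hφ, rfl⟩ := hp.galois x y hpxy
  refine (hp.minimal φ hφ (fun z => ?_) x).symm
  linarith [hp.deck_shift hφ z x]

/-- Lifting of a map to the minimal covering, given a primitive of the Lee form along it. -/
lemma IsMinimalCovering.exists_lift [IsManifold 𝓘(ℝ, E) 1 N]
    (hp : IsMinimalCovering θ p h) {T : Type*} [TopologicalSpace T]
    [PreconnectedSpace T] (c : T → M) (w : T → ℝ)
    (hcw : ∀ t₀, ∀ n₀, p n₀ = c t₀ → ∀ᶠ t in 𝓝 t₀, ∃ n, p n = c t ∧ h n - h n₀ = w t - w t₀)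
    (t₁ : T) (n₁ : N) (hn₁ : p n₁ = c t₁) (t : T) :
    ∃ n, p n = c t ∧ h n - h n₁ = w t - w t₁ := by
  -- The function `w` prescribes the increments of `h` along the lift: it is 0 for orbits and the
  -- time for Lee curves. The set of good parameters is clopen.
  set good : Set T := {t | ∃ n, p n = c t ∧ h n - h n₁ = w t - w t₁}
  have hopen : IsOpen good := by
    rw [isOpen_iff_mem_nhds]
    rintro t₀ ⟨n₀, hn₀, hh⟩
    filter_upwards [hcw t₀ n₀ hn₀]
    rintro t ⟨n, hn, hh'⟩
    exact ⟨n, hn, by linarith⟩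
  have hclosed : IsClosed good := by
    rw [← isOpen_compl_iff, isOpen_iff_mem_nhds]
    intro t₀ ht₀
    obtain ⟨n₀, hn₀⟩ := hp.surjective (c t₀)
    filter_upwards [hcw t₀ n₀ hn₀]
    rintro t ⟨n, hn, hh⟩ ⟨n', hn', hh'⟩
    apply ht₀
    -- Two points over `c t` differ by a deck transformation. It shifts `h` by a constant, so
    -- applying it to `n₀` makes `t₀` good as well.
    obtain ⟨φ, hφ, rfl⟩ := hp.galois n n' (hn.trans hn'.symm)
    refine ⟨φ n₀, (hφ n₀).trans hn₀, ?_⟩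
    linarith [hp.deck_shift hφ n n₀]
  have huniv : good = Set.univ :=
    IsClopen.eq_univ ⟨hclosed, hopen⟩ ⟨t₁, n₁, hn₁, by ring⟩
  exact huniv.ge (Set.mem_univ t)

end Sections

/-! ### The lifted action and its restriction to the hypersurface. -/

section Lift

variable {F : Type*} [NormedAddCommGroup F] [NormedSpace ℝ F]
  {G : Type*} [TopologicalSpace G] [ChartedSpace F G] [Group G] [LieGroup 𝓘(ℝ, F) ∞ G]
  {E : Type*} [NormedAddCommGroup E] [NormedSpace ℝ E]
  {M : Type*} [TopologicalSpace M] [ChartedSpace E M] [IsManifold 𝓘(ℝ, E) ∞ M]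
  {N : Type*} [TopologicalSpace N] [ChartedSpace E N] [IsManifold 𝓘(ℝ, E) ∞ N]
  {θ : OneForm E M} {A : SmoothAction F G E M} {p : N → M} {h : N → ℝ}

/-- The derivative of a function along an orbit, at an arbitrary group element. -/
lemma SmoothAction.mvfderiv_orbit_eq_zero (A : SmoothAction F G E M) {u : M → ℝ} {x : M} {b : G}
    (hu : MDifferentiableAt 𝓘(ℝ, E) 𝓘(ℝ, ℝ) u (A.act b x))
    (h0 : ∀ X, mvfderiv 𝓘(ℝ, E) u (A.act b x) (A.fundamental (A.act b x) X) = 0)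
    (Y : TangentSpace 𝓘(ℝ, F) b) :
    MDifferentiableAt 𝓘(ℝ, F) 𝓘(ℝ, ℝ) (fun a => u (A.act a x)) b ∧
    mvfderiv 𝓘(ℝ, F) (fun a => u (A.act a x)) b Y = 0 := by
  have hd : ∀ (z : M) (c : G), MDifferentiableAt 𝓘(ℝ, F) 𝓘(ℝ, E) (fun a => A.act a z) c :=
    fun z c => (A.contMDiff_orbit z).mdifferentiableAt (by simp)
  have h1 : MDifferentiableAt 𝓘(ℝ, F) 𝓘(ℝ, ℝ) (fun a => u (A.act a (A.act b x))) 1 := by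
    refine MDifferentiableAt.comp (I' := 𝓘(ℝ, E)) (1 : G) (g := u) ?_ (hd _ _)
    rwa [A.one_act]
  -- Right translation by `b⁻¹` moves the derivative at `b` to the identity.
  have h2 : MDifferentiableAt 𝓘(ℝ, F) 𝓘(ℝ, F) (fun a : G => a * b⁻¹) b :=
    (contMDiff_mul_right (I := 𝓘(ℝ, F)) (n := ∞) (a := b⁻¹)).mdifferentiableAt (by simp)
  have h3 : (fun a => u (A.act a x))
      = (fun a => u (A.act a (A.act b x))) ∘ (fun a : G => a * b⁻¹) := by
    ext a
    simp [← A.mul_act]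
  refine ⟨hu.comp b (hd x b), ?_⟩
  rw [h3, mvfderiv_comp_apply_of_eq b h1 h2 (mul_inv_cancel b)]
  exact (A.mvfderiv_fundamental hu _).trans (h0 _)

/-- Near each group element, a local primitive of a `1`-form that vanishes on the fundamental
vector fields is constant along orbits. -/
lemma SmoothAction.eventually_primitive_orbit_eq (A : SmoothAction F G E M)
    (hfund : ∀ X x, θ x (A.fundamental x X) = 0) {W : Set M} (hW : IsOpen W) {u : M → ℝ}
    (hu : ∀ y ∈ W, MDifferentiableAt 𝓘(ℝ, E) 𝓘(ℝ, ℝ) u y ∧ ∀ v, mvfderiv 𝓘(ℝ, E) u y v = θ y v)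
    {x : M} {b : G} (hb : A.act b x ∈ W) :
    ∀ᶠ a in 𝓝 b, A.act a x ∈ W ∧ u (A.act a x) = u (A.act b x) := by
  have hG : IsManifold 𝓘(ℝ, F) ∞ G := inferInstance
  have hG : IsManifold 𝓘(ℝ, F) 1 G := inferInstance
  have hmem : (fun a => A.act a x) ⁻¹' W ∈ 𝓝 b :=
    (A.contMDiff_orbit x).continuous.continuousAt.preimage_mem_nhds (hW.mem_nhds hb)
  obtain ⟨V, hVsub, hVo, hbV, hV⟩ := exists_nhds_eqOn_of_mvfderiv_eq_zero (E := F) ℝ hmem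
  filter_upwards [hVo.mem_nhds hbV] with a ha
  refine ⟨hVsub ha, hV (fun a => u (A.act a x)) (fun a ha => ?_) a ha⟩
  have key := fun Y => A.mvfderiv_orbit_eq_zero (b := a) (hu _ (hVsub ha)).1
    (fun X => by rw [(hu _ (hVsub ha)).2, hfund]) Y
  exact ⟨(key 0).1, fun v => (key v).2⟩

/-- An action that preserves the Lee form, and on whose fundamental vector fields the Lee form
vanishes, lifts to the minimal covering, preserving the primitive. -/
lemma IsMinimalCovering.exists_lift_action [PreconnectedSpace G] (hp : IsMinimalCovering θ p h)
    (hinv : ∀ a x v, θ (A.act a x) (mfderiv 𝓘(ℝ, E) 𝓘(ℝ, E) (A.act a) x v) = θ x v)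
    (hfund : ∀ X x, θ x (A.fundamental x X) = 0) :
    ∃ A' : SmoothAction F G E N, (∀ a x, p (A'.act a x) = A.act a (p x)) ∧
      ∀ a x, h (A'.act a x) = h x := by
  have hN : IsManifold 𝓘(ℝ, E) 1 N := inferInstance
  have hM : IsManifold 𝓘(ℝ, E) 1 M := inferInstance
  have hex : ∀ a x, ∃ y, p y = A.act a (p x) ∧ h y = h x := by
    intro a x
    suffices hs : ∀ b n₀, p n₀ = A.act b (p x) →
        ∀ᶠ a in 𝓝 b, ∃ n, p n = A.act a (p x) ∧ h n - h n₀ = (0 : ℝ) - 0 by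
      obtain ⟨y, hy, hy'⟩ := hp.exists_lift (fun a => A.act a (p x)) (fun _ => 0) hs 1 x
        (by simp [A.one_act]) a
      exact ⟨y, hy, by linarith⟩
    intro b n₀ hn₀
    obtain ⟨W, U, s, hW, hU, hnU, hnW, hs, hps, hsp⟩ := exists_local_section hp.localDiffeo n₀
    rw [hn₀] at hnW
    filter_upwards [A.eventually_primitive_orbit_eq hfund hW
      (fun y hy => hp.mvfderiv_comp_section hW hs hps hy) hnW] with a ha
    refine ⟨s (A.act a (p x)), hps _ ha.1, ?_⟩
    rw [ha.2, ← hn₀, (hsp n₀ hnU).2]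
    ring
  choose f hpf hhf using hex
  -- The action laws hold because both sides have the same image under `p` and under `h`; only
  -- smoothness needs work.
  refine ⟨⟨f, fun x => ?_, fun a b x => ?_, ?_⟩, hpf, hhf⟩
  · exact hp.eq_of_eq (by rw [hpf, A.one_act]) (hhf _ _)
  · exact hp.eq_of_eq (by rw [hpf, hpf, hpf, A.mul_act]) (by rw [hhf, hhf, hhf])
  rintro ⟨a₀, n₀⟩
  obtain ⟨W, U, s, hW, hU, hnU, hnW, hs, hps, hsp⟩ :=
    exists_local_section hp.localDiffeo (f a₀ n₀)
  have hpsm := hp.localDiffeo.contMDiff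
  have hmap : ContMDiff (𝓘(ℝ, F).prod 𝓘(ℝ, E)) 𝓘(ℝ, E) ∞
      (fun q : G × N => A.act q.1 (p q.2)) :=
    A.smooth.comp (contMDiff_fst.prodMk (hpsm.comp contMDiff_snd))
  rw [hpf] at hnW
  have hu := fun y hy => hp.mvfderiv_comp_section hW hs hps (y := y) hy
  have hmem : (fun q : G × N => A.act q.1 (p q.2)) ⁻¹' W ∈ 𝓝 (a₀, n₀) :=
    hmap.continuous.continuousAt.preimage_mem_nhds (hW.mem_nhds hnW)
  rw [nhds_prod_eq, Filter.mem_prod_iff] at hmem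
  obtain ⟨V₀, hV₀, W₀, hW₀, hVW⟩ := hmem
  obtain ⟨W₁, hW₁sub, hW₁o, hnW₁, hW₁⟩ := exists_nhds_eqOn_of_mvfderiv_eq_zero (E := E) ℝ hW₀
  have hconst : ∀ a ∈ V₀, ∀ n ∈ W₁,
      h (s (A.act a (p n))) - h n = h (s (A.act a (p n₀))) - h n₀ := by
    intro a ha
    refine hW₁ (fun n => h (s (A.act a (p n))) - h n) fun n hn => ?_
    have hmemW : A.act a (p n) ∈ W := hVW (Set.mk_mem_prod ha (hW₁sub hn))
    have h1 : MDifferentiableAt 𝓘(ℝ, E) 𝓘(ℝ, E) p n := hpsm.mdifferentiableAt (by simp)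
    have h2 : MDifferentiableAt 𝓘(ℝ, E) 𝓘(ℝ, E) (A.act a) (p n) :=
      (A.contMDiff_act a).mdifferentiableAt (by simp)
    obtain ⟨h3, h4⟩ := hu _ hmemW
    have h5 : MDifferentiableAt 𝓘(ℝ, E) 𝓘(ℝ, ℝ) (fun y => h (s (A.act a y))) (p n) := h3.comp _ h2
    have h6 : MDifferentiableAt 𝓘(ℝ, E) 𝓘(ℝ, ℝ) (fun n => h (s (A.act a (p n)))) n := h5.comp n h1
    have h7 : MDifferentiableAt 𝓘(ℝ, E) 𝓘(ℝ, ℝ) h n :=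
      hp.primitive_smooth.mdifferentiableAt (by simp)
    refine ⟨h6.sub h7, fun v => ?_⟩
    rw [mvfderiv_fun_sub h6 h7]
    have e1 : mvfderiv 𝓘(ℝ, E) (fun n => h (s (A.act a (p n)))) n v
        = mvfderiv 𝓘(ℝ, E) (fun y => h (s (A.act a y))) (p n) (mfderiv 𝓘(ℝ, E) 𝓘(ℝ, E) p n v) :=
      mvfderiv_comp_apply n h5 h1 v
    have e2 := mvfderiv_comp_apply (p n) h3 h2 (mfderiv 𝓘(ℝ, E) 𝓘(ℝ, E) p n v)
    rw [h4, hinv] at e2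
    change mvfderiv 𝓘(ℝ, E) (fun n => h (s (A.act a (p n)))) n v - mvfderiv 𝓘(ℝ, E) h n v = 0
    rw [e1, hp.primitive]
    exact sub_eq_zero.2 e2
  -- Near (a₀, n₀) the lift is s(a · p(n)). The value of `h` there equals h(n): the difference is
  -- constant in n by `hconst`, and at n₀ it is constant in a along the orbit and zero at a₀.
  have hev : (fun q : G × N => f q.1 q.2) =ᶠ[𝓝 (a₀, n₀)]
      fun q => s (A.act q.1 (p q.2)) := by
    rw [nhds_prod_eq]
    filter_upwards [Filter.prod_mem_prod (Filter.inter_mem hV₀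
      (A.eventually_primitive_orbit_eq hfund hW hu hnW)) (hW₁o.mem_nhds hnW₁)]
    rintro ⟨a, n⟩ ⟨⟨ha, -, ha'⟩, hn⟩
    have hmemW : A.act a (p n) ∈ W := hVW (Set.mk_mem_prod ha (hW₁sub hn))
    refine hp.eq_of_eq (by simp only [hpf, hps _ hmemW]) ?_
    have h1 := hconst a ha n hn
    have h2 : h (s (A.act a₀ (p n₀))) = h n₀ := by
      rw [← hpf, (hsp _ hnU).2, hhf]
    simp only at ha'
    simp only [hhf]
    linarith
  exact ((hs _ hnW).comp (a₀, n₀) hmap.contMDiffAt).congr_of_eventuallyEq hev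

variable {K : Type*} [NormedAddCommGroup K] [NormedSpace ℝ K]
  {S : Type*} [TopologicalSpace S] [ChartedSpace K S] [IsManifold 𝓘(ℝ, K) ∞ S]

/-- A lifted action that preserves the primitive restricts to the zero level set. -/
lemma IsAssociatedHypersurface.exists_restrict {ι : S → N}
    (hι : IsAssociatedHypersurface (E := E) (K := K) h ι) (A' : SmoothAction F G E N)
    (hA' : ∀ a x, h (A'.act a x) = h x) :
    ∃ B : SmoothAction F G K S, ∀ a s, ι (B.act a s) = A'.act a (ι s) := by
  have hinj : Function.Injective ι := hι.embedding.isEmbedding.injective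
  have hzero : ∀ s, h (ι s) = 0 := fun s => hι.range_eq.le ⟨s, rfl⟩
  have hex : ∀ a s, ∃ t, ι t = A'.act a (ι s) := fun a s =>
    hι.range_eq.ge (show h (A'.act a (ι s)) = 0 by rw [hA', hzero])
  choose f hf using hex
  have hsm : ContMDiff (𝓘(ℝ, F).prod 𝓘(ℝ, K)) 𝓘(ℝ, E) ∞
      (ι ∘ fun q : G × S => f q.1 q.2) := by
    have h1 : (ι ∘ fun q : G × S => f q.1 q.2) = fun q => A'.act q.1 (ι q.2) := by
      ext q; exact hf _ _
    rw [h1]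
    exact A'.smooth.comp (contMDiff_fst.prodMk (hι.embedding.contMDiff.comp contMDiff_snd))
  refine ⟨⟨f, fun s => hinj (by rw [hf, A'.one_act]), fun a b s => hinj (by
    rw [hf, hf, hf, A'.mul_act]), ?_⟩, hf⟩
  -- A continuous map into an immersed manifold is smooth once its composite with the immersion is;
  -- continuity comes from the topological embedding.
  rw [ContMDiff.iff_comp_isImmersion hι.embedding.isImmersion]
  exact ⟨hι.embedding.isEmbedding.continuous_iff.2 hsm.continuous, hsm⟩

end Lift


/-! ### The covariant derivative of the complex structure. -/

section LeviCivita

variable {E : Type*} [NormedAddCommGroup E] [NormedSpace ℝ E]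
  {M : Type*} [TopologicalSpace M] [ChartedSpace E M] [IsManifold 𝓘(ℝ, E) ∞ M]
  [Bundle.RiemannianBundle (fun x : M => TangentSpace 𝓘(ℝ, E) x)]
  {D : CovariantDerivative 𝓘(ℝ, E) E (fun x : M => TangentSpace 𝓘(ℝ, E) x)}
  {J : EndField E M} {θ : OneForm E M}

/-- The covariant derivative of `J` in the direction `v`, applied to the vector field `Y`. -/
noncomputable def derivEndField (D : CovariantDerivative 𝓘(ℝ, E) E (fun x : M => TangentSpace 𝓘(ℝ, E) x))
    (J : EndField E M) (Y : VField E M) (x : M) (v : TangentSpace 𝓘(ℝ, E) x) :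
    TangentSpace 𝓘(ℝ, E) x :=
  D (fun y => J y (Y y)) x v - J x (D Y x v)

lemma IsLCK.inner_endField_left (hM : IsLCK J θ) (x : M) (u v : TangentSpace 𝓘(ℝ, E) x) :
    inner ℝ (J x u) v = -inner ℝ u (J x v) := by
  rw [← hM.hermitian x (J x u) v, hM.complex.sq_eq_neg, inner_neg_left]

lemma covariantDerivative_neg {Y : VField E M} {x : M} (hY : Y.DiffAt x)
    (v : TangentSpace 𝓘(ℝ, E) x) : D (fun y => -Y y) x v = -D Y x v := by
  have h := (D.isCovariantDerivativeOn (s := Set.univ)).smul_const (-1 : ℝ) hY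
  have h1 : ((-1 : ℝ) • Y) = fun y => -Y y := by
    ext y
    exact neg_one_smul ℝ (Y y)
  rw [h1] at h
  rw [h]
  simp

/-- Differentiating J² = -1 shows that ∇J anticommutes with J. -/
lemma derivEndField_comp (hJ : IsComplexStructure J) {Y : VField E M} {x : M} (hY : Y.DiffAt x)
    (v : TangentSpace 𝓘(ℝ, E) x) :
    derivEndField D J (fun y => J y (Y y)) x v = -J x (derivEndField D J Y x v) := by
  unfold derivEndField
  have h1 : (fun y => J y (J y (Y y))) = fun y => -Y y := funext fun y => hJ.sq_eq_neg y _
  rw [h1, covariantDerivative_neg hY, map_sub, hJ.sq_eq_neg]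
  abel

variable [IsContMDiffRiemannianBundle 𝓘(ℝ, E) ∞ E (fun x : M => TangentSpace 𝓘(ℝ, E) x)]

lemma IsLeviCivita.mvfderiv_fundamentalForm (hD : IsLeviCivita D) (hM : IsLCK J θ)
    {Y Z : VField E M} {x : M}
    (hY : Y.DiffAt x) (hZ : Z.DiffAt x) (v : TangentSpace 𝓘(ℝ, E) x) :
    mvfderiv 𝓘(ℝ, E) (fun y => fundamentalForm J y (Y y) (Z y)) x v
      = inner ℝ (derivEndField D J Y x v) (Z x) + inner ℝ (J x (D Y x v)) (Z x)
        + inner ℝ (J x (Y x)) (D Z x v) := by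
  have h := hD.metric x v _ Z (hM.complex.smooth.diffAt hY) hZ
  unfold fundamentalForm derivEndField
  rw [h, inner_sub_left]
  ring

/-- J is skew for the metric and the metric is parallel, so ∇J is skew too. -/
lemma IsLeviCivita.inner_derivEndField_swap (hD : IsLeviCivita D) (hM : IsLCK J θ)
    {Y Z : VField E M} {x : M}
    (hY : Y.DiffAt x) (hZ : Z.DiffAt x) (v : TangentSpace 𝓘(ℝ, E) x) :
    inner ℝ (derivEndField D J Z x v) (Y x) = -inner ℝ (derivEndField D J Y x v) (Z x) := by
  have h1 := hD.mvfderiv_fundamentalForm hM hY hZ v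
  have h2 := hD.mvfderiv_fundamentalForm hM hZ hY v
  have h3 : (fun y => fundamentalForm J y (Z y) (Y y))
      = fun y => -fundamentalForm J y (Y y) (Z y) := by
    ext y
    unfold fundamentalForm
    rw [hM.inner_endField_left, real_inner_comm]
  have h4 : mvfderiv 𝓘(ℝ, E) (fun y => -fundamentalForm J y (Y y) (Z y)) x v
      = -mvfderiv 𝓘(ℝ, E) (fun y => fundamentalForm J y (Y y) (Z y)) x v := by
    have := mvfderiv_real_comp (r := fun t => -t) (c := -1) (hasDerivAt_neg _)
      (fundamentalForm_mdifferentiableAt hM.complex.smooth hY hZ) v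
    rw [this.2]
    ring
  rw [h3, h4, h1] at h2
  rw [hM.inner_endField_left x (D Y x v), hM.inner_endField_left x (D Z x v),
    real_inner_comm (D Y x v), real_inner_comm (D Z x v)] at h2
  linarith

/-- For a torsion-free connection dω is the cyclic sum of ∇ω: the derivatives of the vector fields
cancel against the brackets. -/
lemma IsLeviCivita.extDeriv_fundamentalForm_eq (hD : IsLeviCivita D) (hM : IsLCK J θ)
    {X Y Z : VField E M} {x : M} (hX : X.DiffAt x) (hY : Y.DiffAt x) (hZ : Z.DiffAt x) :
    extDerivTwoForm (fundamentalForm J) X Y Z x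
      = inner ℝ (derivEndField D J Y x (X x)) (Z x) + inner ℝ (derivEndField D J Z x (Y x)) (X x)
        + inner ℝ (derivEndField D J X x (Z x)) (Y x) := by
  unfold extDerivTwoForm
  rw [hD.mvfderiv_fundamentalForm hM hY hZ, hD.mvfderiv_fundamentalForm hM hX hZ,
    hD.mvfderiv_fundamentalForm hM hX hY, ← hD.torsionFree x X Y hX hY,
    ← hD.torsionFree x X Z hX hZ, ← hD.torsionFree x Y Z hY hZ]
  have h1 := hD.inner_derivEndField_swap hM hX hZ (Y x)
  have sw : ∀ u v : TangentSpace 𝓘(ℝ, E) x, inner ℝ (J x u) v = -inner ℝ (J x v) u := by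
    intro u v
    rw [hM.inner_endField_left, real_inner_comm]
  unfold fundamentalForm
  simp only [map_sub, inner_sub_left]
  rw [sw (Y x) (D Z x (X x)), sw (X x) (D Z x (Y x)), sw (X x) (D Y x (Z x))]
  linarith

/-- Replacing brackets by torsion-free differences turns the Nijenhuis tensor into an expression in
∇J alone. -/
lemma IsLeviCivita.nijenhuis_eq (hD : IsLeviCivita D) (hM : IsLCK J θ)
    {Y Z : VField E M} {x : M} (hY : Y.DiffAt x) (hZ : Z.DiffAt x) :
    derivEndField D J Z x (J x (Y x)) - derivEndField D J Y x (J x (Z x))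
      + J x (derivEndField D J Y x (Z x)) - J x (derivEndField D J Z x (Y x)) = 0 := by
  have hJY := hM.complex.smooth.diffAt hY
  have hJZ := hM.complex.smooth.diffAt hZ
  have h := hM.complex.nijenhuis x Y Z hY hZ
  rw [← hD.torsionFree x _ _ hJY hJZ, ← hD.torsionFree x _ _ hJY hZ,
    ← hD.torsionFree x _ _ hY hJZ, ← hD.torsionFree x _ _ hY hZ] at h
  rw [← h]
  unfold derivEndField
  simp only [map_sub, hM.complex.sq_eq_neg]
  abel

/-- The covariant derivative of the complex structure of a locally conformally Kähler manifold is
determined by the exterior derivative of the fundamental form. -/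
lemma IsLeviCivita.two_inner_derivEndField (hD : IsLeviCivita D) (hM : IsLCK J θ)
    {X Y Z : VField E M} {x : M} (hX : X.DiffAt x) (hY : Y.DiffAt x) (hZ : Z.DiffAt x) :
    2 * inner ℝ (derivEndField D J Y x (X x)) (Z x)
      = extDerivTwoForm (fundamentalForm J) X Y Z x
        - extDerivTwoForm (fundamentalForm J) X (fun y => J y (Y y)) (fun y => J y (Z y)) x := by
  have hJX := hM.complex.smooth.diffAt hX
  have hJY := hM.complex.smooth.diffAt hY
  have hJZ := hM.complex.smooth.diffAt hZ
  rw [hD.extDeriv_fundamentalForm_eq hM hX hY hZ, hD.extDeriv_fundamentalForm_eq hM hX hJY hJZ,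
    derivEndField_comp hM.complex hY, derivEndField_comp hM.complex hZ]
  -- Both exterior derivatives are cyclic sums of ∇J. The terms not differentiated along X cancel by
  -- the Nijenhuis relation paired with J X and the symmetries of ∇J.
  have h1 := congrArg (fun w => inner ℝ w (J x (X x))) (hD.nijenhuis_eq hM hY hZ)
  simp only [inner_add_left, inner_sub_left, inner_zero_left, hM.hermitian] at h1
  have h2 := hD.inner_derivEndField_swap hM hY hJX (J x (Z x))
  rw [derivEndField_comp hM.complex hX, inner_neg_left, hM.inner_endField_left] at h2
  have h3 := hD.inner_derivEndField_swap hM hX hY (Z x)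
  have h4 := hM.inner_endField_left x (derivEndField D J Z x (J x (Y x))) (X x)
  simp only [inner_neg_left, hM.hermitian]
  linarith

end LeviCivita

/-! ### The Lee field of a Vaisman manifold. -/

section Vaisman

variable {E : Type*} [NormedAddCommGroup E] [NormedSpace ℝ E] [FiniteDimensional ℝ E]
  {M : Type*} [TopologicalSpace M] [ChartedSpace E M] [IsManifold 𝓘(ℝ, E) ∞ M]
  [Bundle.RiemannianBundle (fun x : M => TangentSpace 𝓘(ℝ, E) x)]
  [IsContMDiffRiemannianBundle 𝓘(ℝ, E) ∞ E (fun x : M => TangentSpace 𝓘(ℝ, E) x)]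
  {D : CovariantDerivative 𝓘(ℝ, E) E (fun x : M => TangentSpace 𝓘(ℝ, E) x)}
  {J : EndField E M} {θ : OneForm E M}

lemma IsLCK.sharp_diffAt (hM : IsLCK J θ) (x : M) : (sharp θ).DiffAt x :=
  (sharp_smoothAt (hM.smoothAt x)).diffAt

lemma IsVaisman.lee_sharp (hM : IsVaisman J θ) (x : M) : θ x (sharp θ x) = 1 := by
  rw [← inner_sharp, real_inner_self_eq_norm_sq, norm_sharp, hM.unit_length, one_pow]

/-- The field dual to a parallel form is parallel. -/
lemma IsLeviCivita.sharp_eq_zero (hD : IsLeviCivita D) (hM : IsLCK J θ)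
    (hθ : ∀ (x : M) (v : TangentSpace 𝓘(ℝ, E) x) (Y : VField E M), Y.DiffAt x →
      mvfderiv 𝓘(ℝ, E) (fun y => θ y (Y y)) x v - θ x (D Y x v) = 0)
    (x : M) (v : TangentSpace 𝓘(ℝ, E) x) : D (sharp θ) x v = 0 := by
  refine ext_inner_right ℝ fun w => ?_
  obtain ⟨Y, hY, rfl⟩ := exists_smoothAt_eq x w
  have h1 := hD.metric x v (sharp θ) Y (hM.sharp_diffAt x) hY.diffAt
  have h2 := hθ x v Y hY.diffAt
  simp only [inner_sharp] at h1
  rw [inner_zero_left]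
  linarith

/-- The complex structure of a Vaisman manifold is parallel along the Lee field. -/
lemma IsLeviCivita.derivEndField_sharp (hD : IsLeviCivita D) (hM : IsVaisman J θ)
    {Y : VField E M} {x : M} (hY : Y.DiffAt x) : derivEndField D J Y x (sharp θ x) = 0 := by
  refine ext_inner_right ℝ fun w => ?_
  obtain ⟨Z, hZ, rfl⟩ := exists_smoothAt_eq x w
  have hL := hM.toIsLCK
  have h := hD.two_inner_derivEndField hL (hL.sharp_diffAt x) hY hZ.diffAt
  rw [hL.extDeriv_fundamentalForm (hL.sharp_diffAt x) hY hZ.diffAt,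
    hL.extDeriv_fundamentalForm (hL.sharp_diffAt x) (hL.complex.smooth.diffAt hY)
      (hL.complex.smooth.diffAt hZ.diffAt)] at h
  -- With ω(ξ, J ·) = θ and ω(ξ, ·) = -θ ∘ J, the expressions θ ∧ ω on (ξ, Y, Z) and on (ξ, J Y, J
  -- Z) coincide.
  simp only [fundamentalForm, hL.hermitian, hL.inner_endField_left x (sharp θ x), inner_sharp] at h
  rw [inner_zero_left]
  linarith

/-- A function that satisfies `dk = k θ` on a connected manifold vanishes unless `θ` is exact. -/
lemma eq_zero_of_mvfderiv_eq_smul [PreconnectedSpace M] (hM : IsLCK J θ)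
    (hex : ¬ IsExactOneForm θ) {k : M → ℝ} (hk : ContMDiff 𝓘(ℝ, E) 𝓘(ℝ, ℝ) ∞ k)
    (hdk : ∀ x v, mvfderiv 𝓘(ℝ, E) k x v = k x * θ x v) (x : M) : k x = 0 := by
  have : IsManifold 𝓘(ℝ, E) 1 M := inferInstance
  have hkd : ∀ y, MDifferentiableAt 𝓘(ℝ, E) 𝓘(ℝ, ℝ) k y := fun y =>
    hk.mdifferentiableAt (by simp)
  have hloc : IsLocallyConstant (fun y => k y = 0) := by
    rw [IsLocallyConstant.iff_eventually_eq]
    intro x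
    obtain ⟨U, hU, hx, f, hf, hfθ⟩ := hM.exists_primitive x
    obtain ⟨W, hWU, hWo, hxW, hW⟩ :=
      exists_nhds_eqOn_of_mvfderiv_eq_zero (E := E) ℝ (hU.mem_nhds hx)
    filter_upwards [hWo.mem_nhds hxW] with y hy
    -- If θ = df locally, then e^{-f}k is locally constant, so the zero set of `k` is open and
    -- closed.
    have hc := hW (fun y => Real.exp (-f y) * k y) (fun y hy => ?_) y hy
    · have hp := Real.exp_pos (-f x)
      have hp' := Real.exp_pos (-f y)
      have h1 : Real.exp (-f y) * k y = 0 ↔ Real.exp (-f x) * k x = 0 := by rw [hc]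
      simpa [hp.ne', hp'.ne'] using h1
    · have hfy : MDifferentiableAt 𝓘(ℝ, E) 𝓘(ℝ, ℝ) f y :=
        (hf y (hWU hy)).mdifferentiableAt (by simp)
      have hexp : HasDerivAt (fun t : ℝ => Real.exp (-t)) (-Real.exp (-f y)) (f y) := by
        simpa using (hasDerivAt_neg (f y)).exp
      have he := fun v => mvfderiv_real_comp hexp hfy v
      refine ⟨(he 0).1.mul (hkd y), fun v => ?_⟩
      rw [mvfderiv_fun_mul (he 0).1 (hkd y)]
      simp only [add_apply, smul_apply, smul_eq_mul]
      rw [(he v).2, hdk, hfθ y (hWU hy)]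
      ring
  by_contra hx
  have hne : ∀ y, k y ≠ 0 := fun y hy => hx (by
    have := hloc.apply_eq_of_isPreconnected isPreconnected_univ (Set.mem_univ y) (Set.mem_univ x)
    exact this.mp hy)
  -- `Real.log` is log |·|, so the sign of `k` does not matter.
  refine hex ⟨fun y => Real.log (k y), fun y => ?_, fun y => ?_⟩
  · exact (Real.contDiffAt_log.2 (hne y)).contMDiffAt.comp y (hk y)
  · ext v
    rw [(mvfderiv_real_comp (Real.hasDerivAt_log (hne y)) (hkd y) v).2, hdk]
    field_simp [hne y]

end Vaisman

/-! ### The formula for the twisted moment map. -/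

section MomentMap

variable {F : Type*} [NormedAddCommGroup F] [NormedSpace ℝ F]
  {G : Type*} [TopologicalSpace G] [ChartedSpace F G] [Group G] [LieGroup 𝓘(ℝ, F) ∞ G]
  {E : Type*} [NormedAddCommGroup E] [NormedSpace ℝ E] [FiniteDimensional ℝ E]
  {M : Type*} [TopologicalSpace M] [ChartedSpace E M] [IsManifold 𝓘(ℝ, E) ∞ M]
  [Bundle.RiemannianBundle (fun x : M => TangentSpace 𝓘(ℝ, E) x)]
  [IsContMDiffRiemannianBundle 𝓘(ℝ, E) ∞ E (fun x : M => TangentSpace 𝓘(ℝ, E) x)]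
  {J : EndField E M} {θ : OneForm E M} {A : SmoothAction F G E M}

/-- Holomorphic isometries preserve the Lee field. -/
lemma SmoothAction.ByVaismanAutomorphisms.mfderiv_sharp (hA : A.ByVaismanAutomorphisms J)
    (hM : IsLCK J θ) (a : G) (x : M) :
    mfderiv 𝓘(ℝ, E) 𝓘(ℝ, E) (A.act a) x (sharp θ x) = sharp θ (A.act a x) := by
  refine ext_inner_right ℝ fun w => ?_
  obtain ⟨e, he⟩ := A.isInvertible_mfderiv a x
  obtain ⟨v, rfl⟩ : ∃ v, mfderiv 𝓘(ℝ, E) 𝓘(ℝ, E) (A.act a) x v = w := by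
    rw [← he]
    exact e.surjective w
  rw [hA.isometric, inner_sharp, inner_sharp, hA.lee_invariant hM]

/-- The moment map of a Vaisman manifold is constant along the Lee field. -/
lemma IsTwistedMomentMap.mvfderiv_sharp_eq_zero [PreconnectedSpace M]
    {μ : M → LieDual F G} (hμ : IsTwistedMomentMap J θ A μ)
    (hA : A.ByVaismanAutomorphisms J) (hM : IsVaisman J θ) (X : GroupLieAlgebra 𝓘(ℝ, F) G) (x : M) :
    mvfderiv 𝓘(ℝ, E) (fun y => μ y X) x (sharp θ x) = 0 := by
  have : CompleteSpace E := FiniteDimensional.complete ℝ E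
  obtain ⟨D, hD, hθ⟩ := hM.parallel
  have hL := hM.toIsLCK
  have hμd : ∀ y, MDifferentiableAt 𝓘(ℝ, E) 𝓘(ℝ, ℝ) (fun y => μ y X) y := fun y =>
    (hμ.smooth X).mdifferentiableAt (by simp)
  refine eq_zero_of_mvfderiv_eq_smul hL hM.strict
    (k := fun y => mvfderiv 𝓘(ℝ, E) (fun y => μ y X) y (sharp θ y)) (fun y => ?_) (fun y v => ?_) x
  · exact (OneForm.smoothAt_of_eventually_mvfderiv
      (θ := fun y => mvfderiv 𝓘(ℝ, E) (fun y => μ y X) y) (hμ.smooth X y)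
      (Filter.Eventually.of_forall fun _ => rfl)).contMDiffAt (sharp_smoothAt (hL.smoothAt y))
  · obtain ⟨V, hV, rfl⟩ := exists_smoothAt_eq y v
    have hVd := hV.diffAt
    have hξ := hL.sharp_diffAt y
    have hfd := (A.fundamental_smoothAt X y).diffAt
    have hJf := hL.complex.smooth.diffAt hfd
    -- As ξ is parallel, [V, ξ] = -∇_ξ V, hence V(ξμ) = ξ(Vμ) - (∇_ξ V)μ. Expanding Vμ by the moment
    -- map equation leaves kθ(V) + g(∇_ξ(J X̄), V).
    have h1 := mvfderiv_mlieBracket ((hμ.smooth X y).of_le ENat.LEInfty.out) hVd hξ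
    rw [← hD.torsionFree y V _ hVd hξ, hD.sharp_eq_zero hL hθ, zero_sub, map_neg] at h1
    have h2 : (fun z => mvfderiv 𝓘(ℝ, E) (fun y => μ y X) z (V z)) = fun z =>
        μ z X * θ z (V z) + inner ℝ (J z (A.fundamental z X)) (V z) := by
      ext z
      have := hμ.eq X z (V z)
      unfold fundamentalForm at this
      linarith
    have hθV : MDifferentiableAt 𝓘(ℝ, E) 𝓘(ℝ, ℝ) (fun z => θ z (V z)) y :=
      (hL.smoothAt y).mdifferentiableAt hVd
    have h3 : mvfderiv 𝓘(ℝ, E) (fun z => μ z X * θ z (V z)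
          + inner ℝ (J z (A.fundamental z X)) (V z)) y (sharp θ y)
        = mvfderiv 𝓘(ℝ, E) (fun y => μ y X) y (sharp θ y) * θ y (V y)
          + μ y X * θ y (D V y (sharp θ y))
          + (inner ℝ (D (fun z => J z (A.fundamental z X)) y (sharp θ y)) (V y)
          + inner ℝ (J y (A.fundamental y X)) (D V y (sharp θ y))) := by
      have hmul : MDifferentiableAt 𝓘(ℝ, E) 𝓘(ℝ, ℝ) (fun z => μ z X * θ z (V z)) y :=
        (hμd y).mul hθV
      rw [mvfderiv_fun_add hmul (hJf.inner hVd), mvfderiv_fun_mul (hμd y) hθV]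
      simp only [add_apply, smul_apply, smul_eq_mul]
      rw [hD.metric y _ _ V hJf hVd]
      have := hθ y (sharp θ y) V hVd
      linear_combination μ y X * this
    -- From [X̄, ξ] = 0 and ∇ξ = 0, torsion-freeness gives ∇_ξ X̄ = 0; then use ∇_ξ J = 0.
    have h4 : D (fun z => J z (A.fundamental z X)) y (sharp θ y) = 0 := by
      have e1 := hD.derivEndField_sharp hM hfd
      have e2 := hD.torsionFree y _ _ hfd hξ
      rw [hD.sharp_eq_zero hL hθ, A.mlieBracket_fundamental_eq_zero hξ
        (fun a z => hA.mfderiv_sharp hL a z), zero_sub, neg_eq_zero] at e2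
      rw [derivEndField, e2, map_zero, sub_zero] at e1
      exact e1
    rw [h2, h3, h4, inner_zero_left] at h1
    have h5 := hμ.eq X y (D V y (sharp θ y))
    unfold fundamentalForm at h5
    linarith

/-- The moment map of a Vaisman manifold is the contraction of the fundamental vector fields with
the form `-θ ∘ J`. -/
lemma IsTwistedMomentMap.apply_eq [PreconnectedSpace M]
    {μ : M → LieDual F G} (hμ : IsTwistedMomentMap J θ A μ)
    (hA : A.ByVaismanAutomorphisms J) (hM : IsVaisman J θ) (X : GroupLieAlgebra 𝓘(ℝ, F) G) (x : M) :
    μ x X = -θ x (J x (A.fundamental x X)) := by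
  have h := hμ.eq X x (sharp θ x)
  rw [hμ.mvfderiv_sharp_eq_zero hA hM, hM.lee_sharp, fundamentalForm, real_inner_comm,
    inner_sharp] at h
  linarith

end MomentMap


/-! ### Regularity of integral curves. -/

section IntegralCurves

open Set

variable {E : Type*} [NormedAddCommGroup E] [NormedSpace ℝ E]
  {M : Type*} [TopologicalSpace M] [ChartedSpace E M] [IsManifold 𝓘(ℝ, E) ∞ M]
  {v : VField E M} {γ : ℝ → M}

lemma continuousOn_tangentCoordChange_apply [IsManifold 𝓘(ℝ, E) 1 M]
    (hv : Continuous (fun x => (⟨x, v x⟩ : TangentBundle 𝓘(ℝ, E) M)))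
    (x₀ : M) : ContinuousOn (fun x => tangentCoordChange 𝓘(ℝ, E) x x₀ x (v x))
      (chartAt E x₀).source := by
  have h := (trivializationAt E (TangentSpace 𝓘(ℝ, E)) x₀).continuousOn_toFun.comp
    (f := fun x => (⟨x, v x⟩ : TangentBundle 𝓘(ℝ, E) M)) (s := (chartAt E x₀).source)
    hv.continuousOn (fun x hx => by
      rw [Bundle.Trivialization.source_eq]
      simpa using hx)
  exact continuous_snd.comp_continuousOn h

/-- In a chart the velocity is a continuous function of time. The C¹ regularity is what allows the
length of the curve to be measured. -/
lemma contMDiffAt_of_isMIntegralCurveAt [IsManifold 𝓘(ℝ, E) 1 M]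
    (hv : Continuous (fun x => (⟨x, v x⟩ : TangentBundle 𝓘(ℝ, E) M))) {t₀ : ℝ}
    (hγ : IsMIntegralCurveAt γ v t₀) : ContMDiffAt 𝓘(ℝ, ℝ) 𝓘(ℝ, E) 1 γ t₀ := by
  rw [contMDiffAt_iff]
  refine ⟨hγ.continuousAt, ?_⟩
  rw [modelWithCornersSelf_coe, Set.range_id, contDiffWithinAt_univ]
  have hsrc : ∀ᶠ t in 𝓝 t₀, γ t ∈ (chartAt E (γ t₀)).source :=
    hγ.continuousAt.eventually ((chartAt E (γ t₀)).open_source.mem_nhds (mem_chart_source E _))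
  obtain ⟨u, hu, hu'⟩ := (hγ.eventually_hasDerivAt.and (hsrc.and
    (hγ.mono fun t ht => ht.continuousAt))).exists_mem
  have hmain := contDiffAt_one_iff.2 ⟨fun t => ContinuousLinearMap.toSpanSingleton ℝ
    (tangentCoordChange 𝓘(ℝ, E) (γ t) (γ t₀) (γ t) (v (γ t))), u, hu, ?_, fun t ht =>
      (hu' t ht).1.hasFDerivAt⟩
  · exact hmain
  · have h1 : ContinuousOn (fun t => tangentCoordChange 𝓘(ℝ, E) (γ t) (γ t₀) (γ t) (v (γ t))) u :=
      (continuousOn_tangentCoordChange_apply hv (γ t₀)).comp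
        (fun t ht => (hu' t ht).2.2.continuousWithinAt) (fun t ht => (hu' t ht).2.1)
    exact (ContinuousLinearMap.toSpanSingletonLIE ℝ E).continuous.comp_continuousOn h1

end IntegralCurves

/-! ### Completeness of bounded vector fields. -/

section Complete

open Set

variable {E : Type*} [NormedAddCommGroup E] [NormedSpace ℝ E]
  {M : Type*} [MetricSpace M] [ChartedSpace E M] [IsManifold 𝓘(ℝ, E) ∞ M]
  [Bundle.RiemannianBundle (fun x : M => TangentSpace 𝓘(ℝ, E) x)]
  [IsRiemannianManifold 𝓘(ℝ, E) M] {v : VField E M} {γ : ℝ → M}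

/-- Integral curves of a vector field of norm at most one are `1`-Lipschitz. -/
lemma lipschitzOnWith_of_isMIntegralCurveOn [IsManifold 𝓘(ℝ, E) 1 M]
    (hv : Continuous (fun x => (⟨x, v x⟩ : TangentBundle 𝓘(ℝ, E) M)))
    (hbound : ∀ x, ‖v x‖ ≤ 1) {a b : ℝ} (hγ : IsMIntegralCurveOn γ v (Ioo a b)) :
    LipschitzOnWith 1 γ (Ioo a b) := by
  have key : ∀ s ∈ Ioo a b, ∀ t ∈ Ioo a b, s ≤ t → edist (γ s) (γ t) ≤ edist s t := by
    intro s hs t ht hst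
    have hsub : Icc s t ⊆ Ioo a b := fun r hr => ⟨hs.1.trans_le hr.1, hr.2.trans_lt ht.2⟩
    have hat : ∀ r ∈ Icc s t, IsMIntegralCurveAt γ v r := fun r hr =>
      hγ.isMIntegralCurveAt (Ioo_mem_nhds (hsub hr).1 (hsub hr).2)
    rw [IsRiemannianManifold.out (I := 𝓘(ℝ, E)) (γ s) (γ t)]
    refine (Manifold.riemannianEDist_le_pathELength (fun r hr =>
      (contMDiffAt_of_isMIntegralCurveAt hv (hat r hr)).contMDiffWithinAt) rfl rfl hst).trans ?_
    rw [Manifold.pathELength_eq_lintegral_mfderiv_Icc]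
    calc _ ≤ ∫⁻ r in Icc s t, 1 := by
          refine MeasureTheory.setLIntegral_mono' measurableSet_Icc fun r hr => ?_
          have h1 : mfderiv 𝓘(ℝ, ℝ) 𝓘(ℝ, E) γ r (1 : ℝ) = v (γ r) := by
            rw [(hat r hr).hasMFDerivAt.mfderiv]
            exact one_smul ℝ (v (γ r))
          erw [h1]
          rw [← ofReal_norm, ← ENNReal.ofReal_one]
          exact ENNReal.ofReal_le_ofReal (hbound _)
      _ = edist s t := by
          rw [MeasureTheory.setLIntegral_one, Real.volume_Icc, edist_dist, Real.dist_eq,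
            abs_sub_comm, abs_of_nonneg (sub_nonneg.2 hst)]
  intro s hs t ht
  rw [ENNReal.coe_one, one_mul]
  rcases le_total s t with h | h
  · exact key s hs t ht h
  · rw [edist_comm, edist_comm s]
    exact key t ht s hs h

/-- On a complete manifold, an integral curve of a bounded vector field extends beyond the right
end of its interval of definition. -/
lemma exists_isMIntegralCurveOn_right [FiniteDimensional ℝ E] [CompleteSpace M]
    (hv : ContMDiff 𝓘(ℝ, E) (𝓘(ℝ, E).prod 𝓘(ℝ, E)) 1
      (fun x => (⟨x, v x⟩ : TangentBundle 𝓘(ℝ, E) M)))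
    (hbound : ∀ x, ‖v x‖ ≤ 1) {a b : ℝ} (hab : a < b) (hγ : IsMIntegralCurveOn γ v (Ioo a b)) :
    ∃ γ' : ℝ → M, ∃ ε > 0, EqOn γ' γ (Ioo a b) ∧ IsMIntegralCurveOn γ' v (Ioo a (b + ε)) := by
  have : IsManifold 𝓘(ℝ, E) 1 M := inferInstance
  have : CompleteSpace E := FiniteDimensional.complete ℝ E
  have hcont := hv.continuous
  have hlip := lipschitzOnWith_of_isMIntegralCurveOn hcont hbound hγ
  -- the limit at the end point
  obtain ⟨y, hy⟩ : ∃ y, Filter.Tendsto γ (𝓝[<] b) (𝓝 y) := by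
    apply cauchy_map_iff_exists_tendsto.1
    have h1 : Cauchy (𝓝[Ioo a b] b) := by
      have : Filter.NeBot (𝓝[Ioo a b] b) := by
        rw [nhdsWithin_Ioo_eq_nhdsLT hab]; infer_instance
      exact cauchy_nhds.mono inf_le_left
    rw [← nhdsWithin_Ioo_eq_nhdsLT hab]
    exact h1.map_of_le hlip.uniformContinuousOn inf_le_right
  -- The curve is restarted at its limit point `y`, and the two pieces are glued at time `b`.
  obtain ⟨σ, hσb, hσ⟩ := exists_isMIntegralCurveAt_of_contMDiffAt_boundaryless b (hv y)
  obtain ⟨ε, hε, hσε⟩ := isMIntegralCurveAt_iff'.1 hσ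
  rw [Real.ball_eq_Ioo] at hσε
  set δ : ℝ → M := fun t => if t < b then γ t else σ t
  have hδγ : EqOn δ γ (Iio b) := fun t ht => if_pos ht
  have hδσ : EqOn δ σ (Ici b) := fun t ht => if_neg (not_lt.2 ht)
  have hδb : δ b = y := (hδσ self_mem_Ici).trans hσb
  refine ⟨δ, ε, hε, fun t ht => hδγ ht.2, fun t ht => HasMFDerivAt.hasMFDerivWithinAt ?_⟩
  rcases lt_trichotomy t b with htb | rfl | htb
  · have hev : δ =ᶠ[𝓝 t] γ := Filter.eventuallyEq_of_mem (Iio_mem_nhds htb) hδγ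
    rw [hδγ htb]
    exact ((hγ t ⟨ht.1, htb⟩).hasMFDerivAt (Ioo_mem_nhds ht.1 htb)).congr_of_eventuallyEq hev
  · have hct : ContinuousAt δ t := by
      rw [continuousAt_iff_continuous_left'_right']
      constructor
      · unfold ContinuousWithinAt
        rw [hδb]
        exact hy.congr' (Filter.eventually_of_mem self_mem_nhdsWithin fun s hs => (hδγ hs).symm)
      · have h1 : ContinuousWithinAt σ (Ioi t) t := hσ.continuousAt.continuousWithinAt
        exact h1.congr (fun s hs => hδσ (Ioi_subset_Ici_self hs)) (hδσ self_mem_Ici)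
    have hsrc : ∀ᶠ s in 𝓝 t, δ s ∈ (chartAt E (δ t)).source :=
      hct.eventually ((chartAt E (δ t)).open_source.mem_nhds (mem_chart_source E _))
    set w : M → E := fun x => tangentCoordChange 𝓘(ℝ, E) x (δ t) x (v x)
    have hw : ContinuousAt w (δ t) := (continuousOn_tangentCoordChange_apply hcont (δ t)).continuousAt
      ((chartAt E (δ t)).open_source.mem_nhds (mem_chart_source E _))
    have hwt : w (δ t) = v (δ t) := tangentCoordChange_self (mem_extChartAt_source _)
    set u : ℝ → E := extChartAt 𝓘(ℝ, E) (δ t) ∘ δ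
    have hu : ContinuousAt u t := (continuousAt_extChartAt (δ t)).comp hct
    have hleft : ∀ᶠ s in 𝓝[<] t, HasDerivAt u (w (δ s)) s := by
      have hδ : IsMIntegralCurveOn δ v (Ioo a t) := fun s hs => by
        rw [hδγ hs.2]
        exact HasMFDerivWithinAt.congr_of_eventuallyEq (hγ s hs)
          (Filter.eventually_of_mem self_mem_nhdsWithin fun r hr => hδγ hr.2) (hδγ hs.2)
      filter_upwards [Ioo_mem_nhdsLT ht.1, nhdsWithin_le_nhds hsrc] with s hs hs'
      refine (hδ.hasDerivWithinAt (t₀ := t) hs ?_).hasDerivAt (Ioo_mem_nhds hs.1 hs.2)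
      rwa [extChartAt_source]
    have hright : HasDerivWithinAt u (w (δ t)) (Ici t) t := by
      have hδ : IsMIntegralCurveOn δ v (Ico t (t + ε)) := fun s hs => by
        rw [hδσ hs.1]
        have hsub : Ico t (t + ε) ⊆ Ioo (t - ε) (t + ε) := fun r hr =>
          ⟨by linarith [hr.1], hr.2⟩
        exact HasMFDerivWithinAt.congr_of_eventuallyEq ((hσε s (hsub hs)).mono hsub)
          (Filter.eventually_of_mem self_mem_nhdsWithin fun r hr => hδσ hr.1) (hδσ hs.1)
      have h1 := hδ.hasDerivWithinAt (t₀ := t) ⟨le_rfl, by linarith⟩ (mem_extChartAt_source _)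
      exact h1.mono_of_mem_nhdsWithin (Ico_mem_nhdsGE (by linarith))
    -- At the gluing time the right derivative comes from `σ`; the left one is the limit of the
    -- derivatives, as `w ∘ δ` is continuous.
    have hder : HasDerivAt u (w (δ t)) t := by
      obtain ⟨r, hr, hr'⟩ := hleft.exists_mem
      have h1 : HasDerivWithinAt u (w (δ t)) (Iic t) t := by
        refine hasDerivWithinAt_Iic_of_tendsto_deriv (s := r)
          (fun s hs => (hr' s hs).differentiableAt.differentiableWithinAt)
          hu.continuousWithinAt hr ?_
        refine (Filter.Tendsto.mono_left (hw.comp hct) nhdsWithin_le_nhds).congr' ?_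
        filter_upwards [hr] with s hs using (hr' s hs).deriv.symm
      rw [← hasDerivWithinAt_univ, ← Iic_union_Ici]
      exact h1.union hright
    refine ⟨hct, ?_⟩
    rw [modelWithCornersSelf_coe, Set.range_id, ← hwt]
    exact hder.hasFDerivAt.hasFDerivWithinAt
  · have hev : δ =ᶠ[𝓝 t] σ := Filter.eventuallyEq_of_mem (Ioi_mem_nhds htb)
      fun s hs => hδσ (Ioi_subset_Ici_self hs)
    have ht' : t ∈ Ioo (b - ε) (b + ε) := ⟨by linarith, ht.2⟩
    rw [hδσ (le_of_lt htb)]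
    exact ((hσε t ht').hasMFDerivAt (Ioo_mem_nhds ht'.1 ht'.2)).congr_of_eventuallyEq hev

/-- Time reversal: apply the extension to the right to the field `-v`. -/
lemma exists_isMIntegralCurveOn_left [FiniteDimensional ℝ E] [CompleteSpace M]
    (hv : ContMDiff 𝓘(ℝ, E) (𝓘(ℝ, E).prod 𝓘(ℝ, E)) 1
      (fun x => (⟨x, v x⟩ : TangentBundle 𝓘(ℝ, E) M)))
    (hbound : ∀ x, ‖v x‖ ≤ 1) {a b : ℝ} (hab : a < b) (hγ : IsMIntegralCurveOn γ v (Ioo a b)) :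
    ∃ γ' : ℝ → M, ∃ ε > 0, EqOn γ' γ (Ioo a b) ∧ IsMIntegralCurveOn γ' v (Ioo (a - ε) b) := by
  have : IsManifold 𝓘(ℝ, E) 1 M := inferInstance
  have hneg : ContMDiff 𝓘(ℝ, E) (𝓘(ℝ, E).prod 𝓘(ℝ, E)) 1
      (fun x => (⟨x, ((-1 : ℝ) • v) x⟩ : TangentBundle 𝓘(ℝ, E) M)) :=
    ContMDiff.const_smul_section hv
  have h1 := hγ.comp_mul (-1)
  have e1 : {t : ℝ | t * -1 ∈ Ioo a b} = Ioo (-b) (-a) := by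
    ext t
    simp only [mem_ofPred_eq, mem_Ioo]
    constructor <;> rintro ⟨h, h'⟩ <;> constructor <;> linarith
  rw [e1] at h1
  obtain ⟨γ', ε, hε, heq, h2⟩ := exists_isMIntegralCurveOn_right hneg
    (fun x => by simpa [norm_smul] using hbound x) (by linarith) h1
  refine ⟨γ' ∘ (· * -1), ε, hε, fun t ht => ?_, ?_⟩
  · have := heq (x := t * -1) ⟨by linarith [ht.2], by linarith [ht.1]⟩
    simpa using this
  · have h3 := h2.comp_mul (-1)
    have e2 : {t : ℝ | t * -1 ∈ Ioo (-b) (-a + ε)} = Ioo (a - ε) b := by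
      ext t
      simp only [mem_ofPred_eq, mem_Ioo]
      constructor <;> rintro ⟨h, h'⟩ <;> constructor <;> linarith
    rwa [e2, smul_smul, neg_one_mul, neg_neg, one_smul] at h3

/-- A bounded vector field on a complete Riemannian manifold is complete. -/
lemma exists_isMIntegralCurve_of_norm_le [FiniteDimensional ℝ E] [CompleteSpace M]
    (hv : ContMDiff 𝓘(ℝ, E) (𝓘(ℝ, E).prod 𝓘(ℝ, E)) 1
      (fun x => (⟨x, v x⟩ : TangentBundle 𝓘(ℝ, E) M)))
    (hbound : ∀ x, ‖v x‖ ≤ 1) (x : M) : ∃ γ : ℝ → M, γ 0 = x ∧ IsMIntegralCurve γ v := by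
  have : IsManifold 𝓘(ℝ, E) 1 M := inferInstance
  have : CompleteSpace E := FiniteDimensional.complete ℝ E
  rw [exists_isMIntegralCurve_iff_exists_isMIntegralCurveOn_Ioo hv]
  -- `P` is a down-set with a positive element. It contains a larger element above each of its
  -- positive elements and, by gluing, contains its supremum when bounded; so it is all of ℝ.
  set P : Set ℝ := {a | ∃ γ : ℝ → M, γ 0 = x ∧ IsMIntegralCurveOn γ v (Ioo (-a) a)}
  have hmono : ∀ a ∈ P, ∀ b ≤ a, b ∈ P := by
    rintro a ⟨γ, h0, hγ⟩ b hb
    exact ⟨γ, h0, hγ.mono (Ioo_subset_Ioo (by linarith) hb)⟩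
  have hpos : ∃ a ∈ P, 0 < a := by
    obtain ⟨σ, h0, hσ⟩ := exists_isMIntegralCurveAt_of_contMDiffAt_boundaryless 0 (hv x)
    obtain ⟨ε, hε, hσε⟩ := isMIntegralCurveAt_iff'.1 hσ
    rw [Real.ball_eq_Ioo, zero_sub, zero_add] at hσε
    exact ⟨ε, ⟨σ, h0, hσε⟩, hε⟩
  have hext : ∀ a ∈ P, 0 < a → ∃ b ∈ P, a < b := by
    rintro a ⟨γ, h0, hγ⟩ ha
    obtain ⟨γ₁, ε₁, hε₁, heq₁, hγ₁⟩ := exists_isMIntegralCurveOn_right hv hbound (by linarith) hγ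
    obtain ⟨γ₂, ε₂, hε₂, heq₂, hγ₂⟩ := exists_isMIntegralCurveOn_left hv hbound (by linarith) hγ₁
    refine ⟨a + min ε₁ ε₂, ⟨γ₂, ?_, hγ₂.mono (Ioo_subset_Ioo ?_ ?_)⟩, ?_⟩
    · rw [heq₂ ⟨by linarith, by linarith⟩, heq₁ ⟨by linarith, ha⟩, h0]
    · linarith [min_le_right ε₁ ε₂]
    · linarith [min_le_left ε₁ ε₂]
    · linarith [lt_min hε₁ hε₂]
  have hunion : ∀ c : ℝ, (∀ a < c, a ∈ P) → c ∈ P := by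
    intro c hc
    have : Nonempty M := ⟨x⟩
    choose! γ h0 hγ using hc
    rcases le_or_gt c 0 with hc0 | hc0
    · refine ⟨fun _ => x, rfl, ?_⟩
      rw [Ioo_eq_empty (by linarith)]
      exact fun t ht => ht.elim
    -- The midpoint of |t| and c: a radius below `c` whose interval still contains `t`.
    set r : ℝ → ℝ := fun t => (|t| + c) / 2
    have hr : ∀ t ∈ Ioo (-c) c, r t < c ∧ t ∈ Ioo (-r t) (r t) := fun t ht => by
      have h1 : |t| < c := abs_lt.2 ht
      refine ⟨by simp only [r]; linarith, abs_lt.1 ?_⟩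
      simp only [r]
      linarith
    have hr0 : ∀ t, 0 < r t := fun t => by
      have := abs_nonneg t
      simp only [r]
      linarith
    have hagree : ∀ a b, 0 < a → a ≤ b → b < c → EqOn (γ a) (γ b) (Ioo (-a) a) := by
      intro a b ha hab hb
      exact isMIntegralCurveOn_Ioo_eqOn_of_contMDiff_boundaryless (t₀ := 0) ⟨by linarith, ha⟩ hv
        (hγ a (hab.trans_lt hb))
        ((hγ b hb).mono (Ioo_subset_Ioo (by linarith) hab))
        (by rw [h0 a (hab.trans_lt hb), h0 b hb])
    refine ⟨fun t => γ (r t) t, h0 _ (hr 0 ⟨by linarith, hc0⟩).1, fun t ht =>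
      HasMFDerivAt.hasMFDerivWithinAt ?_⟩
    obtain ⟨h1, h2⟩ := hr t ht
    refine ((hγ _ h1 t h2).hasMFDerivAt (Ioo_mem_nhds h2.1 h2.2)).congr_of_eventuallyEq ?_
    filter_upwards [Ioo_mem_nhds h2.1 h2.2, Ioo_mem_nhds ht.1 ht.2] with s hs hs'
    obtain ⟨h3, h4⟩ := hr s hs'
    rcases le_total (r s) (r t) with h | h
    · exact hagree _ _ (hr0 s) h h1 h4
    · exact (hagree _ _ (hr0 t) h h3 hs).symm
  intro a
  by_contra ha
  have hbdd : BddAbove P := ⟨a, fun b hb => by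
    by_contra! h
    exact ha (hmono b hb a h.le)⟩
  obtain ⟨a₀, ha₀, hpos₀⟩ := hpos
  have hsup : sSup P ∈ P := hunion _ fun b hb => by
    obtain ⟨d, hd, hbd⟩ := exists_lt_of_lt_csSup ⟨a₀, ha₀⟩ hb
    exact hmono d hd b hbd.le
  obtain ⟨b, hb, hb'⟩ := hext _ hsup (hpos₀.trans_le (le_csSup hbdd ha₀))
  exact absurd (le_csSup hbdd hb) (not_le.2 hb')

end Complete


section IntegralCurveComp

variable {E : Type*} [NormedAddCommGroup E] [NormedSpace ℝ E]
  {M : Type*} [TopologicalSpace M] [ChartedSpace E M]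

/-- The derivative of a function along an integral curve. -/
lemma hasDerivAt_comp_of_isMIntegralCurve {v : VField E M} {γ : ℝ → M}
    (hγ : IsMIntegralCurve γ v) {g : M → ℝ} {t : ℝ}
    (hg : MDifferentiableAt 𝓘(ℝ, E) 𝓘(ℝ, ℝ) g (γ t)) :
    HasDerivAt (fun r => g (γ r)) (mvfderiv 𝓘(ℝ, E) g (γ t) (v (γ t))) t := by
  have h1 := (hg.hasMFDerivAt.comp t (hγ t)).hasFDerivAt
  rw [hasDerivAt_iff_hasFDerivAt]
  refine h1.congr_fderiv ?_
  ext
  change mfderiv 𝓘(ℝ, E) 𝓘(ℝ, ℝ) g (γ t) ((1 : ℝ) • v (γ t)) = (1 : ℝ) • mvfderiv 𝓘(ℝ, E) g (γ t) (v (γ t))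
  rw [one_smul, one_smul]
  rfl

end IntegralCurveComp

/-! ### The contact form and the contact moment map. -/

section Contact

variable {F : Type*} [NormedAddCommGroup F] [NormedSpace ℝ F]
  {G : Type*} [TopologicalSpace G] [ChartedSpace F G] [Group G] [LieGroup 𝓘(ℝ, F) ∞ G]
  {E : Type*} [NormedAddCommGroup E] [NormedSpace ℝ E]
  {M : Type*} [TopologicalSpace M] [ChartedSpace E M] [IsManifold 𝓘(ℝ, E) ∞ M]
  {N : Type*} [TopologicalSpace N] [ChartedSpace E N] [IsManifold 𝓘(ℝ, E) ∞ N]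
  {K : Type*} [NormedAddCommGroup K] [NormedSpace ℝ K]
  {S : Type*} [TopologicalSpace S] [ChartedSpace K S] [IsManifold 𝓘(ℝ, K) ∞ S]
  {J : EndField E M} {θ : OneForm E M} {A : SmoothAction F G E M} {B : SmoothAction F G K S}
  {p : N → M} {h : N → ℝ} {ι : S → N}

/-- The contact form is the pullback of `-θ ∘ J`. -/
lemma contactForm_apply (hp : IsMinimalCovering θ p h)
    (hι : IsAssociatedHypersurface (E := E) (K := K) h ι) (s : S) (v : TangentSpace 𝓘(ℝ, K) s) :
    contactForm J p h ι s v
      = -θ (p (ι s)) (J (p (ι s)) (mfderiv 𝓘(ℝ, K) 𝓘(ℝ, E) (p ∘ ι) s v)) := by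
  have h1 : MDifferentiableAt 𝓘(ℝ, E) 𝓘(ℝ, E) p (ι s) :=
    hp.localDiffeo.contMDiff.mdifferentiableAt (by simp)
  have h2 : MDifferentiableAt 𝓘(ℝ, K) 𝓘(ℝ, E) ι s :=
    hι.embedding.contMDiff.mdifferentiableAt (by simp)
  rw [mfderiv_comp_apply s h1 h2]
  change -mvfderiv 𝓘(ℝ, E) h (ι s) (liftEndField J p (ι s) (mfderiv 𝓘(ℝ, K) 𝓘(ℝ, E) ι s v)) = _
  rw [hp.primitive]
  have h3 : (mfderiv 𝓘(ℝ, E) 𝓘(ℝ, E) p (ι s)).IsInvertible :=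
    ⟨(hp.localDiffeo (ι s)).mfderivToContinuousLinearEquiv (by simp), rfl⟩
  obtain ⟨e, he⟩ := h3
  congr 2
  unfold liftEndField
  rw [← he, ContinuousLinearMap.inverse_equiv]
  exact e.apply_symm_apply _

/-- The derivative of the equivariance of p ∘ ι, stated in `E` because the two base points agree
only by a proof. -/
lemma mfderiv_comp_induced (hA : ∀ a s, p (ι (B.act a s)) = A.act a (p (ι s)))
    (hq : ContMDiff 𝓘(ℝ, K) 𝓘(ℝ, E) ∞ (p ∘ ι)) (a : G) (s : S) (v : K) :
    (mfderiv 𝓘(ℝ, K) 𝓘(ℝ, E) (p ∘ ι) (B.act a s) (mfderiv 𝓘(ℝ, K) 𝓘(ℝ, K) (B.act a) s v) : E)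
      = mfderiv 𝓘(ℝ, E) 𝓘(ℝ, E) (A.act a) (p (ι s)) (mfderiv 𝓘(ℝ, K) 𝓘(ℝ, E) (p ∘ ι) s v) := by
  have hqd : ∀ s, MDifferentiableAt 𝓘(ℝ, K) 𝓘(ℝ, E) (p ∘ ι) s := fun s =>
    hq.mdifferentiableAt (by simp)
  have h1 := mfderiv_comp_apply s (hqd (B.act a s))
    ((B.contMDiff_act a).mdifferentiableAt (by simp)) v
  have h2 := mfderiv_comp_apply s (g := A.act a) (f := p ∘ ι)
    ((A.contMDiff_act a).mdifferentiableAt (by simp)) (hqd s) v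
  have h3 : (p ∘ ι) ∘ B.act a = A.act a ∘ (p ∘ ι) := funext fun s => hA a s
  rw [h3] at h1
  exact h1.symm.trans h2

/-- Equivariance of p ∘ ι carries orbit maps to orbit maps; differentiate at the identity. -/
lemma mfderiv_fundamental_induced (hA : ∀ a s, p (ι (B.act a s)) = A.act a (p (ι s)))
    (hq : ContMDiff 𝓘(ℝ, K) 𝓘(ℝ, E) ∞ (p ∘ ι)) (s : S) (X : GroupLieAlgebra 𝓘(ℝ, F) G) :
    mfderiv 𝓘(ℝ, K) 𝓘(ℝ, E) (p ∘ ι) s (B.fundamental s X) = A.fundamental (p (ι s)) X := by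
  have h1 := mfderiv_comp_of_eq (x := (1 : G)) (hq.mdifferentiableAt (x := s) (by simp))
    ((B.contMDiff_orbit s).mdifferentiableAt (by simp)) (B.one_act s)
  have h2 : (p ∘ ι) ∘ (fun a => B.act a s) = fun a => A.act a (p (ι s)) := funext fun a => hA a s
  rw [h2] at h1
  have h3 : ∀ t, t = s → ∀ w : K, (mfderiv 𝓘(ℝ, K) 𝓘(ℝ, E) (p ∘ ι) t w : E)
      = mfderiv 𝓘(ℝ, K) 𝓘(ℝ, E) (p ∘ ι) s w := by rintro t rfl w; rfl
  exact (h3 _ (B.one_act s) _).symm.trans (DFunLike.congr_fun h1 X).symm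

variable [FiniteDimensional ℝ E]
  [Bundle.RiemannianBundle (fun x : M => TangentSpace 𝓘(ℝ, E) x)]
  [IsContMDiffRiemannianBundle 𝓘(ℝ, E) ∞ E (fun x : M => TangentSpace 𝓘(ℝ, E) x)]

/-- Induced actions on the associated Sasakian manifold preserve the contact form. -/
lemma isContact_of_isInducedAction (hM : IsLCK J θ) (hA : A.ByVaismanAutomorphisms J)
    (hp : IsMinimalCovering θ p h) (hι : IsAssociatedHypersurface (E := E) (K := K) h ι)
    (hB : IsInducedAction p ι A B) : B.IsContact (contactForm J p h ι) := by
  obtain ⟨A', hA', hB'⟩ := hB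
  intro a s v
  have hlift : ∀ a s, p (ι (B.act a s)) = A.act a (p (ι s)) := fun a s => by rw [hB', hA']
  have hq : ContMDiff 𝓘(ℝ, K) 𝓘(ℝ, E) ∞ (p ∘ ι) :=
    hp.localDiffeo.contMDiff.comp hι.embedding.contMDiff
  rw [contactForm_apply hp hι, contactForm_apply hp hι]
  have h1 : ∀ y z : M, y = z → ∀ w : E, θ y (J y w) = θ z (J z w) := by rintro y _ rfl w; rfl
  rw [neg_inj]
  refine (h1 _ _ (hlift a s) _).trans ?_
  have h2 := mfderiv_comp_induced hlift hq a s v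
  refine (congrArg (fun w : E => θ (A.act a (p (ι s))) (J (A.act a (p (ι s))) w)) h2).trans ?_
  have h3 := hA.lee_invariant hM a (p (ι s)) (J (p (ι s)) (mfderiv 𝓘(ℝ, K) 𝓘(ℝ, E) (p ∘ ι) s v))
  rw [hA.holomorphic] at h3
  exact h3

/-- The contact moment map is the pullback of the twisted moment map. -/
lemma contactMomentMap_eq [PreconnectedSpace M] (hM : IsVaisman J θ)
    (hA : A.ByVaismanAutomorphisms J) {μ : M → LieDual F G} (hμ : IsTwistedMomentMap J θ A μ)
    (hp : IsMinimalCovering θ p h) (hι : IsAssociatedHypersurface (E := E) (K := K) h ι)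
    (hB : IsInducedAction p ι A B) (s : S) :
    contactMomentMap B (contactForm J p h ι) s = μ (p (ι s)) := by
  obtain ⟨A', hA', hB'⟩ := hB
  ext X
  have hlift : ∀ a s, p (ι (B.act a s)) = A.act a (p (ι s)) := fun a s => by rw [hB', hA']
  have hq : ContMDiff 𝓘(ℝ, K) 𝓘(ℝ, E) ∞ (p ∘ ι) :=
    hp.localDiffeo.contMDiff.comp hι.embedding.contMDiff
  rw [hμ.apply_eq hA hM]
  change contactForm J p h ι s (B.fundamental s X) = _
  rw [contactForm_apply hp hι, mfderiv_fundamental_induced hlift hq]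

end Contact

/-! ### Flowing to the zero level along the Lee field. -/

section Range

variable {F : Type*} [NormedAddCommGroup F] [NormedSpace ℝ F]
  {G : Type*} [TopologicalSpace G] [ChartedSpace F G] [Group G] [LieGroup 𝓘(ℝ, F) ∞ G]
  {E : Type*} [NormedAddCommGroup E] [NormedSpace ℝ E] [FiniteDimensional ℝ E]
  {M : Type*} [MetricSpace M] [ChartedSpace E M] [IsManifold 𝓘(ℝ, E) ∞ M]
  [Bundle.RiemannianBundle (fun x : M => TangentSpace 𝓘(ℝ, E) x)]
  [IsContMDiffRiemannianBundle 𝓘(ℝ, E) ∞ E (fun x : M => TangentSpace 𝓘(ℝ, E) x)]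
  {J : EndField E M} {θ : OneForm E M} {A : SmoothAction F G E M}
  {N : Type*} [TopologicalSpace N] [ChartedSpace E N] [IsManifold 𝓘(ℝ, E) ∞ N]
  {p : N → M} {h : N → ℝ}

/-- Integral curves of the Lee field lift to the minimal covering, where the primitive grows at
unit speed along them. -/
lemma IsMinimalCovering.exists_lift_isMIntegralCurve (hp : IsMinimalCovering θ p h)
    (hM : IsVaisman J θ) {γ : ℝ → M} (hγ : IsMIntegralCurve γ (sharp θ)) {n : N}
    (hn : p n = γ 0) (t : ℝ) : ∃ n', p n' = γ t ∧ h n' - h n = t := by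
  have : IsManifold 𝓘(ℝ, E) 1 N := inferInstance
  have : IsManifold 𝓘(ℝ, E) 1 M := inferInstance
  suffices hs : ∀ t₀ n₀, p n₀ = γ t₀ →
      ∀ᶠ t in 𝓝 t₀, ∃ n, p n = γ t ∧ h n - h n₀ = t - t₀ by
    obtain ⟨n', hn', hh⟩ := hp.exists_lift γ (fun t => t) hs 0 n hn t
    exact ⟨n', hn', by simpa using hh⟩
  intro t₀ n₀ hn₀
  obtain ⟨W, U, s, hW, hU, hnU, hnW, hs, hps, hsp⟩ := exists_local_section hp.localDiffeo n₀
  rw [hn₀] at hnW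
  have hcont : Continuous γ := hγ.continuous
  obtain ⟨ε, hε, hball⟩ := Metric.mem_nhds_iff.1
    (hcont.continuousAt.preimage_mem_nhds (hW.mem_nhds hnW))
  -- The function h ∘ s ∘ γ has derivative θ(ξ) = 1.
  have hder : ∀ t ∈ Metric.ball t₀ ε, HasDerivAt (fun t => h (s (γ t)) - t) 0 t := by
    intro t ht
    obtain ⟨h1, h2⟩ := hp.mvfderiv_comp_section hW hs hps (hball ht)
    have h3 := (hasDerivAt_comp_of_isMIntegralCurve hγ h1).sub (hasDerivAt_id t)
    rw [h2, hM.lee_sharp, sub_self] at h3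
    exact h3
  filter_upwards [Metric.ball_mem_nhds t₀ hε] with t ht
  refine ⟨s (γ t), hps _ (hball ht), ?_⟩
  have hconst := Metric.isOpen_ball.is_const_of_deriv_eq_zero (convex_ball t₀ ε).isPreconnected
    (fun r hr => (hder r hr).differentiableAt.differentiableWithinAt)
    (fun r hr => (hder r hr).deriv) ht (Metric.mem_ball_self hε)
  have h0 : s (γ t₀) = n₀ := by rw [← hn₀, (hsp n₀ hnU).2]
  simp only [h0] at hconst
  linarith

/-- Every value of the twisted moment map is attained on the zero level of the primitive. -/
lemma IsTwistedMomentMap.exists_eq_of_primitive_eq_zero [IsRiemannianManifold 𝓘(ℝ, E) M]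
    [PreconnectedSpace M] [CompleteSpace M] {μ : M → LieDual F G}
    (hμ : IsTwistedMomentMap J θ A μ) (hA : A.ByVaismanAutomorphisms J) (hM : IsVaisman J θ)
    (hp : IsMinimalCovering θ p h) (m : M) : ∃ n, h n = 0 ∧ μ (p n) = μ m := by
  have hv : ContMDiff 𝓘(ℝ, E) (𝓘(ℝ, E).prod 𝓘(ℝ, E)) 1
      (fun x => (⟨x, sharp θ x⟩ : TangentBundle 𝓘(ℝ, E) M)) := fun x =>
    ContMDiffAt.of_le (sharp_smoothAt (hM.toIsLCK.smoothAt x)) ENat.LEInfty.out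
  obtain ⟨γ, rfl, hγ⟩ := exists_isMIntegralCurve_of_norm_le hv
    (fun x => by rw [norm_sharp, hM.unit_length]) m
  obtain ⟨n, hn⟩ := hp.surjective (γ 0)
  -- Flowing for time `-h n` brings the primitive to zero.
  obtain ⟨n', hn', hh⟩ := hp.exists_lift_isMIntegralCurve hM hγ hn (-h n)
  refine ⟨n', by linarith, ?_⟩
  ext X
  have hder : ∀ t, HasDerivAt (fun t => μ (γ t) X) 0 t := fun t => by
    have h1 := hasDerivAt_comp_of_isMIntegralCurve hγ (t := t)
      ((hμ.smooth X).mdifferentiableAt (by simp))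
    rwa [hμ.mvfderiv_sharp_eq_zero hA hM] at h1
  rw [hn']
  exact is_const_of_deriv_eq_zero (fun t => (hder t).differentiableAt) (fun t => (hder t).deriv)
    (-h n) 0

end Range

end VaismanMoment

theorem proposition6p1
    -- a complete connected Vaisman manifold `M`
    {E : Type*} [NormedAddCommGroup E] [NormedSpace ℝ E] [FiniteDimensional ℝ E]
    {M : Type*} [MetricSpace M] [ChartedSpace E M] [IsManifold 𝓘(ℝ, E) ∞ M]
    [Bundle.RiemannianBundle (fun x : M => TangentSpace 𝓘(ℝ, E) x)]
    [IsContMDiffRiemannianBundle 𝓘(ℝ, E) ∞ E (fun x : M => TangentSpace 𝓘(ℝ, E) x)]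
    [IsRiemannianManifold 𝓘(ℝ, E) M] [ConnectedSpace M] [CompleteSpace M]
    (J : VaismanMoment.EndField E M) (θ : VaismanMoment.OneForm E M)
    (hM : VaismanMoment.IsVaisman J θ)
    -- a compact connected Lie group `G`
    {F : Type*} [NormedAddCommGroup F] [NormedSpace ℝ F] [FiniteDimensional ℝ F]
    {G : Type*} [TopologicalSpace G] [T2Space G] [ChartedSpace F G] [Group G]
    [LieGroup 𝓘(ℝ, F) ∞ G] [CompactSpace G] [ConnectedSpace G]
    -- a twisted Hamiltonian action by Vaisman automorphisms, with its twisted moment map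
    (A : VaismanMoment.SmoothAction F G E M) (hA : A.ByVaismanAutomorphisms J)
    (μ : M → VaismanMoment.LieDual F G) (hμ : VaismanMoment.IsTwistedMomentMap J θ A μ)
    -- the minimal covering of `M`
    {N : Type*} [TopologicalSpace N] [ChartedSpace E N] [IsManifold 𝓘(ℝ, E) ∞ N]
    (p : N → M) (h : N → ℝ) (hp : VaismanMoment.IsMinimalCovering θ p h)
    -- the associated Sasakian manifold, as a hypersurface of the minimal covering
    {K : Type*} [NormedAddCommGroup K] [NormedSpace ℝ K] [FiniteDimensional ℝ K]
    {S : Type*} [TopologicalSpace S] [ChartedSpace K S] [IsManifold 𝓘(ℝ, K) ∞ S]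
    (ι : S → N) (hι : VaismanMoment.IsAssociatedHypersurface (E := E) (K := K) h ι) :
    (∃ B : VaismanMoment.SmoothAction F G K S, VaismanMoment.IsInducedAction p ι A B) ∧
    ∀ B : VaismanMoment.SmoothAction F G K S, VaismanMoment.IsInducedAction p ι A B →
      B.IsContact (VaismanMoment.contactForm J p h ι) ∧
      Set.range (VaismanMoment.contactMomentMap B (VaismanMoment.contactForm J p h ι))
        = Set.range μ := by

  have hL := hM.toIsLCK
  refine ⟨?_, fun B hB => ⟨VaismanMoment.isContact_of_isInducedAction hL hA hp hι hB, ?_⟩⟩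
  · obtain ⟨A', hA', hhA'⟩ := hp.exists_lift_action (hA.lee_invariant hL)
      (hμ.lee_fundamental_eq_zero hA hL)
    obtain ⟨B, hB⟩ := hι.exists_restrict A' hhA'
    exact ⟨B, A', hA', hB⟩
  · have hΦ := VaismanMoment.contactMomentMap_eq hM hA hμ hp hι hB
    ext l
    constructor
    · rintro ⟨s, rfl⟩
      exact ⟨p (ι s), (hΦ s).symm⟩
    · rintro ⟨m, rfl⟩
      obtain ⟨n, hn, hμn⟩ := hμ.exists_eq_of_primitive_eq_zero hA hM hp m
      obtain ⟨s, rfl⟩ := hι.range_eq.ge hn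
      exact ⟨s, (hΦ s).trans hμn⟩
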